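/- **Setting.** Let $S$ be a closed connected oriented surface of genus $g\ge 3$, with a standard system of based loops $\alpha_1,\dots,\alpha_g,\beta_1,\dots,\beta_g$, that is, $\pi_1(S)=\langle \alpha_1,\beta_1,\dots,\alpha_g,\beta_g\mid \prod_i[\alpha_i,\beta_i]=1\rangle$; their classes $a_i,b_i$ form a symplectic basis of $H_1(S;\mathbb Z)$. Let $\mathcal I_g$ be the Torelli group of $S$, i.e. the group of mapping classes acting trivially on $H_1(S;\mathbb Z)$. Let $S_\infty\to S$ be the infinite cyclic covering defined by algebraic intersection number with $a_g$ and, for $q\ge 1$, let $S_q\to S$ be the cyclic covering of degree $q$ defined by algebraic intersection number with $a_g$ modulo $q$. Write $G_\infty\cong\mathbb Z$ and $G_q\cong\mathbb Z/q\mathbb Z$ for the deck groups; fix an isomorphism $G_\infty\cong\mathbb Z$, so that $\mathbb Z[G_\infty]=\mathbb Z[t,t^{-1}]$. For $i<g$, lift $\alpha_i,\beta_i$ to closed curves in $S_\infty$ (resp. $S_q$) starting at one fixed lift of the base point. Every $\varphi\in\mathcal I_g$ has a lift to $S_\infty$ (resp. $S_q$), and for every lift there is a unique $(2g-2)\times(2g-2)$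 matrix over $\mathbb Z[t,t^{-1}]$ (resp. $\mathbb Z[G_q]$) that describes the action of the lift on first integral homology on the classes of these $2g-2$ lifted curves, taken in the order $\alpha_1,\dots,\alpha_{g-1},\beta_1,\dots,\beta_{g-1}$. Denote it by $M_\infty(\varphi)$ (resp. $M_q(\hat\varphi)$, for a lift $\hat\varphi$ to $S_q$); $M_\infty(\varphi)$ depends on the chosen lift only up to a factor $t^k$. Let $B_\infty(\varphi)$ be the bottom-left $(g-1)\times(g-1)$ block of $M_\infty(\varphi)$; it expresses the coefficients of the images of the lifted $\alpha_j$ on the lifted $\beta_i$. Let $\iota:\mathbb Z[G_q]\to\mathbb C$ be a ring homomorphism that maps a generator of $G_q$ to a primitive $q$-th root of unity, and let $\rho_q(\hat\varphi)=\iota(M_q(\hat\varphi))$, acting on $\mathbb C^{2g-2}$ with its standard orthonormal basis $x_1,\dots,x_{g-1},y_1,\dots,y_{g-1}$, and on $\wedge^{g-1}\mathbb C^{2g-2}$ with the induced Hermitian inner product $(\cdot,\cdot)$. Put $e=x_1\wedge\dots\wedge x_{g-1}$ and $f=y_1\wedge\dots\wedge y_{g-1}$. Finally, let $m(P)=\frac1{2\pi}\int_0^{2\pi}\log|P(e^{i\theta})|\,d\theta$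 be the logarithmic Mahler measure and $\Phi_k$ the $k$-th cyclotomic polynomial. **Proposition.** Let $\alpha>0$ and let $\mu$ be a finitely supported probability measure on $\mathcal I_g$ whose support generates $\mathcal I_g$ as a semigroup. There is a finite set $K_{\alpha,\mu}$ of positive integers such that the following holds for every $n\ge 0$ and every $\varphi\in\mathrm{supp}(\mu^{*n})$ with $m(\det B_\infty(\varphi))=0$: * either $\Phi_k$ divides $\det B_\infty(\varphi)$ in $\mathbb Z[t,t^{-1}]$ for some $k\in K_{\alpha,\mu}$, and for that $k$ one has $(\rho_k(\hat\varphi)e,f)=0$ for every lift $\hat\varphi$ of $\varphi$ to $S_k$ and every choice of $\iota$; * or $|(\rho_q(\hat\varphi)e,f)|\le \exp(\alpha n)$ for every $q\ge 1$, every lift $\hat\varphi$ of $\varphi$ to $S_q$ and every choice of $\iota$. -/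

import Mathlib

open CategoryTheory AlgebraicTopology Opposite
open scoped unitInterval LaurentPolynomial

noncomputable section

/-! ### First singular homology with integral coefficients -/

/-- The first singular homology group `H₁(X; ℤ)`. -/
abbrev H1 (X : Type) [TopologicalSpace X] : ModuleCat.{0} ℤ :=
  ((singularHomologyFunctor (ModuleCat.{0} ℤ) 1).obj (ModuleCat.of ℤ ℤ)).obj (TopCat.of X)

/-- The map induced on `H₁` by a continuous map. -/
def H1map {X Y : Type} [TopologicalSpace X] [TopologicalSpace Y] (f : C(X, Y)) :
    H1 X →ₗ[ℤ] H1 Y :=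
  (((singularHomologyFunctor (ModuleCat.{0} ℤ) 1).obj (ModuleCat.of ℤ ℤ)).map
    (TopCat.ofHom f)).hom

theorem H1map_id (X : Type) [TopologicalSpace X] :
    H1map (ContinuousMap.id X) = LinearMap.id := by
  unfold H1map
  rw [TopCat.ofHom_id, CategoryTheory.Functor.map_id]
  rfl

theorem H1map_comp {X Y Z : Type} [TopologicalSpace X] [TopologicalSpace Y] [TopologicalSpace Z]
    (g : C(Y, Z)) (f : C(X, Y)) : H1map (g.comp f) = H1map g ∘ₗ H1map f := by
  unfold H1map
  rw [TopCat.ofHom_comp, CategoryTheory.Functor.map_comp]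
  rfl

/-- A homeomorphism as a continuous map. -/
abbrev homeoMap {X : Type} [TopologicalSpace X] (f : X ≃ₜ X) : C(X, X) := ⟨f, f.continuous⟩

/-- The singular `1`-simplex of a path. -/
def pathSimplex {X : Type} [TopologicalSpace X] {x y : X} (γ : Path x y) :
    (TopCat.toSSet.obj (TopCat.of X)).obj (op (SimplexCategory.mk 1)) :=
  ((TopCat.of X).toSSetObjEquiv (op (SimplexCategory.mk 1))).symm
    (γ.toContinuousMap.comp
      ⟨stdSimplexHomeomorphUnitInterval, stdSimplexHomeomorphUnitInterval.continuous⟩)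

theorem pathSimplex_cycle {X : Type} [TopologicalSpace X] {x : X} (γ : Path x x) :
    (TopCat.toSSet.obj (TopCat.of X)).ιChainComplex (R := ModuleCat.of ℤ ℤ) (pathSimplex γ) ≫
      ((TopCat.toSSet.obj (TopCat.of X)).chainComplex (ModuleCat.of ℤ ℤ)).d 1 0 = 0 := by
  have h : (TopCat.toSSet.obj (TopCat.of X)).δ 0 (pathSimplex γ) =
      (TopCat.toSSet.obj (TopCat.of X)).δ 1 (pathSimplex γ) := by
    apply ((TopCat.of X).toSSetObjEquiv (op (SimplexCategory.mk 0))).injective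
    have key : ∀ i : Fin 2, ∀ z, ((TopCat.of X).toSSetObjEquiv (op (SimplexCategory.mk 0)))
        ((TopCat.toSSet.obj (TopCat.of X)).δ i (pathSimplex γ)) z =
        γ (stdSimplexHomeomorphUnitInterval (stdSimplex.map (SimplexCategory.δ i) z)) :=
      fun _ _ => rfl
    ext z
    have hv : ∀ j : Fin 2, γ (stdSimplexHomeomorphUnitInterval (stdSimplex.vertex j)) = x := by
      intro j
      fin_cases j
      · exact γ.source
      · exact γ.target
    have hz : z = stdSimplex.vertex (S := ℝ) (0 : Fin 1) :=
      Subsingleton.elim (α := stdSimplex ℝ (Fin 1)) _ _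
    rw [key, key, hz]
    erw [stdSimplex.map_vertex, stdSimplex.map_vertex, hv, hv]
  rw [SSet.ιChainComplex_d, Fin.sum_univ_two, h]
  simp

/-- The class in `H₁(X; ℤ)` of the singular cycle given by a loop. -/
def loopClass {X : Type} [TopologicalSpace X] {x : X} (γ : Path x x) : H1 X :=
  (((TopCat.toSSet.obj (TopCat.of X)).chainComplex (ModuleCat.of ℤ ℤ)).liftCycles
      ((TopCat.toSSet.obj (TopCat.of X)).ιChainComplex (R := ModuleCat.of ℤ ℤ) (pathSimplex γ))
      0 (ChainComplex.next_nat_succ 0) (pathSimplex_cycle γ) ≫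
    ((TopCat.toSSet.obj (TopCat.of X)).chainComplex (ModuleCat.of ℤ ℤ)).homologyπ 1).hom (1 : ℤ)

/-! ### Mapping class group and Torelli group -/

/-- The homeomorphisms of `S` that are isotopic to the identity. An isotopy is a
homeomorphism of `[0,1] × S` that preserves every level `{t} × S`. -/
def isotopicToId (S : Type) [TopologicalSpace S] : Subgroup (S ≃ₜ S) where
  carrier := {f | ∃ Φ : (I × S) ≃ₜ (I × S), (∀ z, (Φ z).1 = z.1) ∧
    (∀ x, (Φ (0, x)).2 = x) ∧ ∀ x, (Φ (1, x)).2 = f x}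
  one_mem' := ⟨Homeomorph.refl _, fun _ => rfl, fun _ => rfl, fun _ => rfl⟩
  mul_mem' := by
    rintro f g ⟨Φ, h1, h2, h3⟩ ⟨Ψ, k1, k2, k3⟩
    have key : ∀ t x, Ψ (t, x) = (t, (Ψ (t, x)).2) := fun t x => Prod.ext (k1 _) rfl
    refine ⟨Ψ.trans Φ, fun z => ?_, fun x => ?_, fun x => ?_⟩
    · simp [h1, k1]
    · rw [Homeomorph.trans_apply, key, k2, h2]
    · rw [Homeomorph.trans_apply, key, k3, h3, Homeomorph.mul_apply]
  inv_mem' := by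
    rintro f ⟨Φ, h1, h2, h3⟩
    have key : ∀ t x, Φ (t, x) = (t, (Φ (t, x)).2) := fun t x => Prod.ext (h1 _) rfl
    refine ⟨Φ.symm, fun z => ?_, fun x => ?_, fun x => ?_⟩
    · conv_rhs => rw [← Φ.apply_symm_apply z, h1]
    · have : Φ.symm (0, x) = (0, x) := by
        rw [Homeomorph.symm_apply_eq, key, h2]
      rw [this]
    · have : Φ.symm (1, x) = (1, f.symm x) := by
        rw [Homeomorph.symm_apply_eq, key, h3, Homeomorph.apply_symm_apply]
      rw [this]; rfl

instance (S : Type) [TopologicalSpace S] : (isotopicToId S).Normal where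
  conj_mem := by
    rintro f ⟨Φ, h1, h2, h3⟩ g
    have key : ∀ t x, Φ (t, x) = (t, (Φ (t, x)).2) := fun t x => Prod.ext (h1 _) rfl
    let G : (I × S) ≃ₜ (I × S) := (Homeomorph.refl I).prodCongr g
    have hG : ∀ t x, G (t, x) = (t, g x) := fun _ _ => rfl
    have hG' : ∀ t x, G.symm (t, x) = (t, g.symm x) := fun _ _ => rfl
    refine ⟨(G.symm.trans Φ).trans G, ?_, fun x => ?_, fun x => ?_⟩
    · rintro ⟨t, x⟩
      rw [Homeomorph.trans_apply, Homeomorph.trans_apply, hG', key, hG]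
    · rw [Homeomorph.trans_apply, Homeomorph.trans_apply, hG', key, hG, h2,
        Homeomorph.apply_symm_apply]
    · rw [Homeomorph.trans_apply, Homeomorph.trans_apply, hG', key, hG, h3]
      rfl

/-- Isotopy classes of homeomorphisms of `S`. (For a closed oriented surface this contains the
group of orientation-preserving classes with index two; a class acting trivially on `H₁`
preserves the orientation, so the Torelli group below is the same in both groups.) -/
abbrev MappingClassGroup (S : Type) [TopologicalSpace S] : Type :=
  (S ≃ₜ S) ⧸ isotopicToId S

/-- The Torelli group: the mapping classes that act trivially on `H₁(S; ℤ)`. -/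
def Torelli (S : Type) [TopologicalSpace S] : Subgroup (MappingClassGroup S) where
  carrier := {φ | ∃ f : S ≃ₜ S, (f : MappingClassGroup S) = φ ∧
    H1map (homeoMap f) = LinearMap.id}
  one_mem' := ⟨1, rfl, H1map_id S⟩
  mul_mem' := by
    rintro _ _ ⟨f, rfl, hf⟩ ⟨g, rfl, hg⟩
    refine ⟨f * g, rfl, ?_⟩
    have : homeoMap (f * g) = (homeoMap f).comp (homeoMap g) := rfl
    rw [this, H1map_comp, hf, hg]
    rfl
  inv_mem' := by
    rintro _ ⟨f, rfl, hf⟩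
    refine ⟨f⁻¹, rfl, ?_⟩
    have h : (homeoMap f).comp (homeoMap f⁻¹) = ContinuousMap.id S := by
      ext x; exact f.apply_symm_apply x
    have h' := H1map_comp (homeoMap f) (homeoMap f⁻¹)
    rw [h, H1map_id, hf, LinearMap.id_comp] at h'
    exact h'.symm

/-! ### Surfaces with standard curves -/

/-- The relator `[a₁,b₁]⋯[a_g,b_g]`; the letters are `a i = inl i` and `b i = inr i`. -/
def surfaceRelator (g : ℕ) : FreeGroup (Fin g ⊕ Fin g) :=
  (List.ofFn fun i : Fin g =>
    FreeGroup.of (Sum.inl i) * FreeGroup.of (Sum.inr i) * (FreeGroup.of (Sum.inl i))⁻¹ *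
      (FreeGroup.of (Sum.inr i))⁻¹).prod

/-- The fundamental group `⟨a₁,b₁,…,a_g,b_g | [a₁,b₁]⋯[a_g,b_g]⟩` of the closed oriented
surface of genus `g`. -/
abbrev SurfaceGroup (g : ℕ) : Type := PresentedGroup {surfaceRelator g}

/-- The algebraic intersection number with `a i`, as a homomorphism from the surface group
to `ℤ`: it vanishes on all `a j` and is `δ i j` on `b j`. -/
def intersectionWithA {g : ℕ} (i : Fin g) : SurfaceGroup g →* Multiplicative ℤ :=
  PresentedGroup.toGroup
    (f := Sum.elim (fun _ => 1) fun j => if j = i then Multiplicative.ofAdd (1 : ℤ) else 1) (by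
      rintro _ rfl
      rw [surfaceRelator, map_list_prod, List.map_ofFn]
      apply List.prod_eq_one
      intro x hx
      obtain ⟨j, rfl⟩ := (List.mem_ofFn' _ _).1 hx
      simp)

/-- A standard system of based loops on `S`: loops `α i`, `β i` at a common base point whose
classes generate `π₁(S)` subject to the single relation `[α₁,β₁]⋯[α_g,β_g] = 1`.
A closed connected surface carries such a system if and only if it is orientable of genus `g`.
The `α i`, `β i` represent a symplectic basis `a i`, `b i` of `H₁(S; ℤ)`, and `S` bounds a
handlebody in which the `α i` are meridians. -/
structure StandardSystem (g : ℕ) (S : Type) [TopologicalSpace S] where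
  base : S
  α : Fin g → Path base base
  β : Fin g → Path base base
  iso : SurfaceGroup g ≃* FundamentalGroup S base
  iso_a : ∀ i, iso (PresentedGroup.of (Sum.inl i)) =
    FundamentalGroup.fromPath (Path.Homotopic.Quotient.mk (α i))
  iso_b : ∀ i, iso (PresentedGroup.of (Sum.inr i)) =
    FundamentalGroup.fromPath (Path.Homotopic.Quotient.mk (β i))

/-! ### Cyclic covers

Throughout the genus is `g = r + 1`, the indices `1, …, g - 1` are `Fin.castSucc i` for
`i : Fin r`, and the index `g` is `Fin.last r`. -/

/-- A connected covering of `S` that is defined by the algebraic intersection number with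
`a_g` modulo `q`. For `q ≥ 1` it is the cyclic covering `S_q` of degree `q`, and for `q = 0`
it is the infinite cyclic covering `S_∞`. The data contains the lifts of the curves
`α i`, `β i` for `i < g` that start at a chosen lift of the base point. -/
structure CyclicCover {r : ℕ} {S : Type} [TopologicalSpace S] (m : StandardSystem (r + 1) S)
    (q : ℕ) (X : Type) [TopologicalSpace X] where
  proj : C(X, S)
  isCoveringMap : IsCoveringMap proj
  pathConnected : PathConnectedSpace X
  base : X
  proj_base : proj base = m.base
  mem_range_iff : ∀ γ : FundamentalGroup S m.base,
    γ ∈ (FundamentalGroup.mapOfEq proj proj_base).range ↔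
      (q : ℤ) ∣ (intersectionWithA (Fin.last r) (m.iso.symm γ)).toAdd
  liftα : Fin r → Path base base
  liftβ : Fin r → Path base base
  proj_liftα : ∀ i t, proj (liftα i t) = m.α i.castSucc t
  proj_liftβ : ∀ i t, proj (liftβ i t) = m.β i.castSucc t

namespace CyclicCover

variable {r : ℕ} {S : Type} [TopologicalSpace S] {m : StandardSystem (r + 1) S} {q : ℕ}
  {X : Type} [TopologicalSpace X] (c : CyclicCover m q X)

/-- The deck group of the covering. -/
def Deck : Subgroup (X ≃ₜ X) where
  carrier := {d | ∀ x, c.proj (d x) = c.proj x}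
  one_mem' := fun _ => rfl
  mul_mem' := by
    intro d e hd he x
    rw [Homeomorph.mul_apply, hd, he]
  inv_mem' := by
    intro d hd x
    rw [← hd, Homeomorph.inv_apply, Homeomorph.apply_symm_apply]

/-- The integral group ring of the deck group. -/
abbrev DeckRing : Type := MonoidAlgebra ℤ c.Deck

/-- The action of a deck transformation on `H₁`. -/
def deckHom : c.Deck →* Module.End ℤ (H1 X) where
  toFun d := H1map (homeoMap (d : X ≃ₜ X))
  map_one' := H1map_id X
  map_mul' d e := H1map_comp (homeoMap (d : X ≃ₜ X)) (homeoMap (e : X ≃ₜ X))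

/-- The action of the group ring of the deck group on `H₁`. -/
def deckAction : c.DeckRing →ₐ[ℤ] Module.End ℤ (H1 X) :=
  MonoidAlgebra.lift ℤ (Module.End ℤ (H1 X)) c.Deck c.deckHom

/-- The homology classes of the lifted curves: first those of the `α i`, then those of the
`β i`, for `i < g`. Their span over the group ring is `F_∞`, respectively `F_q`. -/
def basisClass : Fin r ⊕ Fin r → H1 X :=
  Sum.elim (fun i => loopClass (c.liftα i)) fun i => loopClass (c.liftβ i)

/-- `F` is a lift of (a representative of) the mapping class `φ`. -/
def IsLift (F : X ≃ₜ X) (φ : MappingClassGroup S) : Prop :=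
  ∃ f : S ≃ₜ S, (f : MappingClassGroup S) = φ ∧ ∀ x, c.proj (F x) = f (c.proj x)

/-- `M` describes the action of `F` on the span of the classes of the lifted curves:
the `j`-th basis class is mapped to `∑ i, M i j • (i-th basis class)`. -/
def IsActionMatrix (F : X ≃ₜ X) (M : Matrix (Fin r ⊕ Fin r) (Fin r ⊕ Fin r) c.DeckRing) : Prop :=
  ∀ j, H1map (homeoMap F) (c.basisClass j) = ∑ i, c.deckAction (M i j) (c.basisClass i)

/-- The matrix, over the group ring of the deck group, of the action of `F` on the span of the
classes of the lifted curves (`M_∞`, respectively `M_q`). -/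
def actionMatrix (F : X ≃ₜ X) : Matrix (Fin r ⊕ Fin r) (Fin r ⊕ Fin r) c.DeckRing :=
  Classical.epsilon (c.IsActionMatrix F)

/-- The identification of the group ring of the deck group with `ℤ[t, t⁻¹]` that is given by
an identification `τ` of the deck group with `ℤ`. -/
def toLaurent (τ : Multiplicative ℤ ≃* c.Deck) : c.DeckRing →ₐ[ℤ] ℤ[T;T⁻¹] :=
  MonoidAlgebra.lift ℤ ℤ[T;T⁻¹] c.Deck
    ((AddMonoidAlgebra.of ℤ ℤ).comp τ.symm.toMonoidHom)

/-- The bottom-left block of the action matrix of `F`, over `ℤ[t, t⁻¹]`. -/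
def B (τ : Multiplicative ℤ ≃* c.Deck) (F : X ≃ₜ X) : Matrix (Fin r) (Fin r) ℤ[T;T⁻¹] :=
  ((c.actionMatrix F).map (c.toLaurent τ)).toBlocks₂₁

/-- The ring homomorphism `ι` maps some generator of the deck group to a primitive `q`-th root
of unity. -/
def IsPrimitive (ι : c.DeckRing →+* ℂ) : Prop :=
  ∃ d : c.Deck, (∀ x, x ∈ Subgroup.zpowers d) ∧
    IsPrimitiveRoot (ι (MonoidAlgebra.of ℤ c.Deck d)) q

/-- `ρ_q(F)`: the endomorphism of `ℂ^{2g-2}` whose matrix in the standard basis `x i`, `y i` is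
the image under `ι` of the action matrix of `F`. -/
def rho (ι : c.DeckRing →+* ℂ) (F : X ≃ₜ X) :
    EuclideanSpace ℂ (Fin r ⊕ Fin r) →ₗ[ℂ] EuclideanSpace ℂ (Fin r ⊕ Fin r) :=
  Matrix.toEuclideanLin ((c.actionMatrix F).map ι)

end CyclicCover

/-! ### The exterior power -/

/-- `u ↦ (u, y₁ ∧ ⋯ ∧ y_k)` for the Hermitian inner product on `Λ^k E` induced by the one of
`E`, which on decomposable vectors is `(v₁ ∧ ⋯ ∧ v_k, y₁ ∧ ⋯ ∧ y_k) = det (v i, y j)`. -/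
def innerWedge {E : Type} [NormedAddCommGroup E] [InnerProductSpace ℂ E] {k : ℕ}
    (u : ⋀[ℂ]^k E) (y : Fin k → E) : ℂ :=
  exteriorPower.pairingDual ℂ E k
    (exteriorPower.ιMulti ℂ k fun j => ((innerSL ℂ (y j) : E →L[ℂ] ℂ) : E →ₗ[ℂ] ℂ)) u

theorem innerWedge_ιMulti {E : Type} [NormedAddCommGroup E] [InnerProductSpace ℂ E] {k : ℕ}
    (v y : Fin k → E) :
    innerWedge (exteriorPower.ιMulti ℂ k v) y =
      (Matrix.of fun i j => inner ℂ (y j) (v i)).det := by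
  simp [innerWedge]

/-- The number `(A e, f)`, where `e = x₁ ∧ ⋯ ∧ x_{g-1}` and `f = y₁ ∧ ⋯ ∧ y_{g-1}` for the
standard orthonormal basis `x i`, `y i` of `ℂ^{2g-2}`, and `A` acts on `Λ^{g-1} ℂ^{2g-2}`. -/
def wedgeEntry {r : ℕ}
    (A : EuclideanSpace ℂ (Fin r ⊕ Fin r) →ₗ[ℂ] EuclideanSpace ℂ (Fin r ⊕ Fin r)) : ℂ :=
  innerWedge
    (exteriorPower.map r A
      (exteriorPower.ιMulti ℂ r fun i => EuclideanSpace.single (Sum.inl i) (1 : ℂ)))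
    fun i => EuclideanSpace.single (Sum.inr i) (1 : ℂ)

/-! ### Mahler measure and random walk -/

/-- The value of an integral Laurent polynomial at `z`. -/
def laurentEval (P : ℤ[T;T⁻¹]) (z : ℂ) : ℂ := P.coeff.sum fun k a => (a : ℂ) * z ^ k

/-- The logarithmic Mahler measure `(2π)⁻¹ ∫₀^{2π} log |P(e^{iθ})| dθ`. -/
def laurentMahler (P : ℤ[T;T⁻¹]) : ℝ :=
  Real.circleAverage (fun z => Real.log ‖laurentEval P z‖) 0 1

/-- The `n`-fold convolution power of a probability measure on a discrete group, i.e. the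
distribution of the `n`-th step of the random walk. -/
def convPow {G : Type} [Group G] (μ : PMF G) : ℕ → PMF G
  | 0 => PMF.pure 1
  | n + 1 => (convPow μ n).bind fun x => μ.map fun y => x * y

end

/-! The action matrices of a Torelli class `φ` on all cyclic covers come from one matrix over
`ℤ[t,t⁻¹]`. Fox derivatives with respect to `α i`, `β i` (`i < g`), with coefficients twisted by the
intersection number with `a_g`, form a crossed homomorphism on the surface group. On the fundamental
group of a cover the twist is trivial, so they descend to homology and read off the coordinates
along the lifted curves (`coord`). This gives uniqueness of the matrix and identifies its entries
with Fox derivatives of the images of the loops (`IsActionMatrix.eq_foxMatrix`). Existence holds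
because the homology is spanned by the translates of the lifted curves and by lifts of `α_g` and
`β_g ^ q`; the two extra coefficients are seen in `H₁(S)`, where a Torelli class acts trivially
(`exists_isActionMatrix`).

Fox derivatives are natural in the coefficient ring, and another representative or another lift only
multiplies the matrix by a power of `t` (`exists_laurentMatrix`). As `(A e, f)` is the determinant
of the bottom-left block, `|(ρ_q e, f)| = |P(z)|` with `P = det B_∞` and `z` a primitive `q`-th root
of unity (`exists_norm_wedgeEntry_eq`).

It remains to bound `P` on the unit circle. Matrices multiply along the walk and `μ` has finite
support, so up to a monomial `P` is a polynomial of degree at most `D n` (`exists_hasWidth_convPow`,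
`exists_toLaurent_eq_det`). If `m(P) = 0` and `P ≠ 0`, Kronecker's theorem makes `P` a signed
monomial times cyclotomic polynomials. Given `ε > 0`, all but finitely many `Φ_k` satisfy `|Φ_k| ≤
exp(ε φ(k))` on the circle (`exists_finset_norm_cyclotomic_le`); `K` is the set of exceptions for `ε
= α / (D + 1)`. If some `Φ_k` with `k ∈ K` divides `P`, then `P` vanishes at all primitive `k`-th
roots of unity. Otherwise the bounds multiply to `|P| ≤ exp(ε deg P) ≤ exp(α n)`. -/

noncomputable section

/-! ### Paths as singular one-chains modulo boundaries -/

section PathChains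

variable {X Y : Type} [TopologicalSpace X] [TopologicalSpace Y]

/-- The integral singular chain complex of a space. -/
abbrev singularChains (X : Type) [TopologicalSpace X] : ChainComplex (ModuleCat.{0} ℤ) ℕ :=
  (TopCat.toSSet.obj (TopCat.of X)).chainComplex (ModuleCat.of ℤ ℤ)

/-- Singular one-chains modulo boundaries. -/
abbrev OneChains (X : Type) [TopologicalSpace X] : ModuleCat.{0} ℤ :=
  (singularChains X).opcycles 1

/-- A singular one-simplex, modulo boundaries. -/
def simplexChain (s : (TopCat.toSSet.obj (TopCat.of X)).obj (op (SimplexCategory.mk 1))) :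
    OneChains X :=
  ((TopCat.toSSet.obj (TopCat.of X)).ιChainComplex (R := ModuleCat.of ℤ ℤ) s ≫
    (singularChains X).pOpcycles 1).hom (1 : ℤ)

/-- A path as a singular one-chain, modulo boundaries. -/
def pathChain {x y : X} (γ : Path x y) : OneChains X :=
  simplexChain (pathSimplex γ)

/-- The alternating sum of the three faces is the boundary of `τ`, which is zero modulo boundaries.
-/
theorem simplexChain_face
    (τ : (TopCat.toSSet.obj (TopCat.of X)).obj (op (SimplexCategory.mk 2))) :
    simplexChain ((TopCat.toSSet.obj (TopCat.of X)).δ 1 τ) =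
      simplexChain ((TopCat.toSSet.obj (TopCat.of X)).δ 2 τ) +
        simplexChain ((TopCat.toSSet.obj (TopCat.of X)).δ 0 τ) := by
  have h : (TopCat.toSSet.obj (TopCat.of X)).ιChainComplex (R := ModuleCat.of ℤ ℤ) τ ≫
      (singularChains X).d 2 1 ≫ (singularChains X).pOpcycles 1 = 0 := by
    rw [HomologicalComplex.d_pOpcycles, Limits.comp_zero]
  rw [SSet.ιChainComplex_d_assoc, Fin.sum_univ_three] at h
  have h' := congrArg (fun f => f.hom (1 : ℤ)) h
  simp [Preadditive.add_comp, Preadditive.neg_comp] at h'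
  simp only [simplexChain, ModuleCat.hom_comp, LinearMap.comp_apply]
  rw [← sub_eq_zero, ← neg_eq_zero, ← h']
  simp
  abel

/-- The path of a continuous map from the standard one-simplex. -/
def simplexPath (u : C(stdSimplex ℝ (Fin 2), X)) :
    Path (u (stdSimplex.vertex 0)) (u (stdSimplex.vertex 1)) where
  toFun t := u (stdSimplexHomeomorphUnitInterval.symm t)
  continuous_toFun := by fun_prop
  source' := by
    congr 1; rw [Homeomorph.symm_apply_eq]; exact stdSimplexHomeomorphUnitInterval_zero.symm
  target' := by
    congr 1; rw [Homeomorph.symm_apply_eq]; exact stdSimplexHomeomorphUnitInterval_one.symm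

theorem pathSimplex_simplexPath (u : C(stdSimplex ℝ (Fin 2), X)) :
    pathSimplex (simplexPath u) =
      ((TopCat.of X).toSSetObjEquiv (op (SimplexCategory.mk 1))).symm u := by
  unfold pathSimplex
  congr 1
  ext z
  simp [simplexPath]

theorem pathSimplex_surjective
    (s : (TopCat.toSSet.obj (TopCat.of X)).obj (op (SimplexCategory.mk 1))) :
    pathSimplex (simplexPath ((TopCat.of X).toSSetObjEquiv _ s)) = s := by
  rw [pathSimplex_simplexPath, Equiv.symm_apply_apply]

theorem face_toSSetObjEquiv (K : C(stdSimplex ℝ (Fin 3), X)) (i : Fin 3) :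
    (TopCat.toSSet.obj (TopCat.of X)).δ i
      (((TopCat.of X).toSSetObjEquiv (op (SimplexCategory.mk 2))).symm K) =
    ((TopCat.of X).toSSetObjEquiv (op (SimplexCategory.mk 1))).symm
      (K.comp ⟨stdSimplex.map (SimplexCategory.δ i), stdSimplex.continuous_map _⟩) := by
  rw [Equiv.eq_symm_apply]
  rfl

theorem pathChain_triangle (K : C(stdSimplex ℝ (Fin 3), X)) {a b c : X}
    (γ₀₁ : Path a b) (γ₁₂ : Path b c) (γ₀₂ : Path a c)
    (h₀₁ : ∀ s : stdSimplex ℝ (Fin 2),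
      γ₀₁ (stdSimplexHomeomorphUnitInterval s) = K (stdSimplex.map (SimplexCategory.δ 2) s))
    (h₁₂ : ∀ s : stdSimplex ℝ (Fin 2),
      γ₁₂ (stdSimplexHomeomorphUnitInterval s) = K (stdSimplex.map (SimplexCategory.δ 0) s))
    (h₀₂ : ∀ s : stdSimplex ℝ (Fin 2),
      γ₀₂ (stdSimplexHomeomorphUnitInterval s) = K (stdSimplex.map (SimplexCategory.δ 1) s)) :
    pathChain γ₀₂ = pathChain γ₀₁ + pathChain γ₁₂ := by
  have key {x y : X} (γ : Path x y) (i : Fin 3) (h : ∀ s : stdSimplex ℝ (Fin 2),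
      γ (stdSimplexHomeomorphUnitInterval s) = K (stdSimplex.map (SimplexCategory.δ i) s)) :
      simplexChain ((TopCat.toSSet.obj (TopCat.of X)).δ i
        (((TopCat.of X).toSSetObjEquiv (op (SimplexCategory.mk 2))).symm K)) = pathChain γ := by
    refine congrArg simplexChain ((face_toSSetObjEquiv K i).trans (congrArg _ ?_))
    exact ContinuousMap.ext fun s => (h s).symm
  rw [← key γ₀₂ 1 h₀₂, ← key γ₀₁ 2 h₀₁, ← key γ₁₂ 0 h₁₂]
  exact simplexChain_face _

theorem continuous_stdSimplex_eval {n : ℕ} (i : Fin n) :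
    Continuous fun s : stdSimplex ℝ (Fin n) => s i :=
  (continuous_apply i).comp continuous_subtype_val

theorem stdSimplex_map_apply {m n : ℕ} (f : Fin m → Fin n) (s : stdSimplex ℝ (Fin m))
    (j : Fin n) : stdSimplex.map f s j = ∑ i with f i = j, s i := by
  rw [stdSimplex.map_coe, FunOnFinite.linearMap_apply_apply]

theorem stdSimplex_face (s : stdSimplex ℝ (Fin 2)) :
    (stdSimplex.map (SimplexCategory.δ (2 : Fin 3)) s : stdSimplex ℝ (Fin 3)) =
      (![s 0, s 1, 0] : Fin 3 → ℝ) ∧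
    (stdSimplex.map (SimplexCategory.δ (1 : Fin 3)) s : stdSimplex ℝ (Fin 3)) =
      (![s 0, 0, s 1] : Fin 3 → ℝ) ∧
    (stdSimplex.map (SimplexCategory.δ (0 : Fin 3)) s : stdSimplex ℝ (Fin 3)) =
      (![0, s 0, s 1] : Fin 3 → ℝ) := by
  have key (i : Fin 3) (k : Fin 2) :
      (SimplexCategory.δ i : SimplexCategory.mk 1 ⟶ SimplexCategory.mk 2) k = i.succAbove k := rfl
  refine ⟨?_, ?_, ?_⟩ <;>
  · funext j
    rw [stdSimplex_map_apply, Finset.sum_filter, Fin.sum_univ_two, key, key]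
    fin_cases j <;> simp [Fin.succAbove]

theorem coe_stdSimplexHomeomorphUnitInterval (s : stdSimplex ℝ (Fin 2)) :
    (stdSimplexHomeomorphUnitInterval s : ℝ) = s 1 := rfl

theorem stdSimplex_fst (s : stdSimplex ℝ (Fin 2)) : s 0 = 1 - s 1 := by
  rw [eq_sub_iff_add_eq, stdSimplex.add_eq_one]

theorem projIcc_stdSimplex (s : stdSimplex ℝ (Fin 2)) :
    Set.projIcc (0 : ℝ) 1 zero_le_one (s 1) = stdSimplexHomeomorphUnitInterval s :=
  Subtype.ext (by
    rw [Set.coe_projIcc, coe_stdSimplexHomeomorphUnitInterval,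
      min_eq_right (stdSimplex.le_one s 1), max_eq_right (stdSimplex.zero_le s 1)])

/-! ### Path chains under concatenation, homotopy and reversal -/

theorem pathChain_refl (x : X) : pathChain (Path.refl x) = 0 := by
  have h := pathChain_triangle (ContinuousMap.const _ x) (Path.refl x) (Path.refl x) (Path.refl x)
    (fun _ => rfl) (fun _ => rfl) (fun _ => rfl)
  simpa using h

/-- The concatenated path, precomposed with the affine map sending the vertices to `0`, `1/2`, `1`,
is a singular triangle whose edges are the three paths. -/
theorem pathChain_trans {x y z : X} (γ : Path x y) (γ' : Path y z) :
    pathChain (γ.trans γ') = pathChain γ + pathChain γ' := by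
  refine pathChain_triangle ⟨fun s => (γ.trans γ').extend (s 1 / 2 + s 2),
    (γ.trans γ').continuous_extend.comp (((continuous_stdSimplex_eval 1).div_const 2).add
      (continuous_stdSimplex_eval 2))⟩ _ _ _
    (fun s => ?_) (fun s => ?_) (fun s => ?_)
  all_goals
    obtain ⟨h2, h1, h0⟩ := stdSimplex_face s
    have e := stdSimplex_fst s
    have p0 := stdSimplex.zero_le s 0
    have p1 := stdSimplex.zero_le s 1
    simp only [ContinuousMap.coe_mk, h2, h1, h0]
    simp
  · rw [Path.extend_apply _ (t := s 1 / 2) ⟨by linarith, by linarith⟩, Path.trans_apply,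
      dif_pos (show s 1 / 2 ≤ 1 / 2 by linarith)]
    congr 1
    ext
    simp only [coe_stdSimplexHomeomorphUnitInterval]
    ring
  · rw [Path.extend_apply _ (t := s 0 / 2 + s 1) ⟨by linarith, by linarith⟩]
    -- At the joint, parameter `1/2`, the concatenation is evaluated by its first branch, so this
    -- point is treated apart.
    rcases eq_or_lt_of_le p1 with h | h
    · have e1 : stdSimplexHomeomorphUnitInterval s = 0 := Subtype.ext h.symm
      rw [Path.trans_apply, dif_pos (show s 0 / 2 + s 1 ≤ 1 / 2 by linarith), e1, γ'.source]
      refine γ.target.symm.trans (congrArg γ (Subtype.ext ?_))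
      simp only [Set.Icc.coe_one]
      linarith
    · rw [Path.trans_apply, dif_neg (show ¬ s 0 / 2 + s 1 ≤ 1 / 2 by linarith)]
      congr 1
      ext
      simp only [coe_stdSimplexHomeomorphUnitInterval]
      linarith
  · rfl

/-- The diagonal `d` cuts the square of the homotopy into two triangles; each compares `d` with one
of the paths, the remaining edge being constant. -/
theorem pathChain_eq_of_homotopic {x y : X} {γ γ' : Path x y} (h : γ.Homotopic γ') :
    pathChain γ = pathChain γ' := by
  obtain ⟨H⟩ := h
  let d : Path x y := ⟨⟨fun t => H (t, t), by fun_prop⟩, by simp, by simp⟩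
  have hA : pathChain d = pathChain γ + pathChain (Path.refl y) := by
    refine pathChain_triangle ⟨fun s => H (Set.projIcc 0 1 zero_le_one (s 2),
      Set.projIcc 0 1 zero_le_one (s 1 + s 2)), by
        have := continuous_stdSimplex_eval (n := 3)
        exact H.continuous.comp ((continuous_projIcc.comp (this 2)).prodMk
          (continuous_projIcc.comp ((this 1).add (this 2))))⟩ _ _ _
      (fun s => ?_) (fun s => ?_) (fun s => ?_)
    all_goals
      obtain ⟨h2, h1, h0⟩ := stdSimplex_face s
      simp [h2, h1, h0, projIcc_stdSimplex, stdSimplex.add_eq_one]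
    all_goals rfl
  have hB : pathChain d = pathChain (Path.refl x) + pathChain γ' := by
    refine pathChain_triangle ⟨fun s => H (Set.projIcc 0 1 zero_le_one (s 1 + s 2),
      Set.projIcc 0 1 zero_le_one (s 2)), by
        have := continuous_stdSimplex_eval (n := 3)
        exact H.continuous.comp ((continuous_projIcc.comp ((this 1).add (this 2))).prodMk
          (continuous_projIcc.comp (this 2)))⟩ _ _ _
      (fun s => ?_) (fun s => ?_) (fun s => ?_)
    all_goals
      obtain ⟨h2, h1, h0⟩ := stdSimplex_face s
      simp [h2, h1, h0, projIcc_stdSimplex, stdSimplex.add_eq_one]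
    all_goals rfl
  rw [pathChain_refl] at hA hB
  rw [← add_zero (pathChain γ), ← hA, hB, zero_add]

theorem pathChain_symm {x y : X} (γ : Path x y) : pathChain γ.symm = -pathChain γ := by
  rw [eq_neg_iff_add_eq_zero, ← pathChain_trans, ← pathChain_refl y]
  exact pathChain_eq_of_homotopic ⟨(Path.Homotopy.reflSymmTrans γ).symm⟩

/-- The chains satisfying `p` form a subgroup, and the quotient map by it kills every simplex, since
every one-simplex is the simplex of a path. Hence the quotient map is zero. -/
theorem oneChains_induction {p : OneChains X → Prop}
    (path : ∀ {x y : X} (γ : Path x y), p (pathChain γ)) (zero : p 0)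
    (add : ∀ a b, p a → p b → p (a + b)) (neg : ∀ a, p a → p (-a)) (a : OneChains X) : p a := by
  let N : AddSubgroup (OneChains X) :=
    { carrier := {a | p a}
      zero_mem' := zero
      add_mem' := fun {a b} ha hb => add a b ha hb
      neg_mem' := fun {a} ha => neg a ha }
  let k : OneChains X ⟶ ModuleCat.of ℤ (OneChains X ⧸ N) :=
    ModuleCat.ofHom
      { toFun := fun a => QuotientAddGroup.mk' N a
        map_add' := map_add _
        map_smul' := fun n a => map_intCast_smul (QuotientAddGroup.mk' N) ℤ ℤ n a }
  have h : k = 0 := by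
    rw [← cancel_epi ((singularChains X).pOpcycles 1)]
    refine SSet.chainComplex_hom_ext fun s => ?_
    ext
    simp only [Limits.comp_zero, ModuleCat.hom_comp, ModuleCat.hom_zero, LinearMap.comp_apply,
      LinearMap.zero_apply]
    refine (QuotientAddGroup.eq_zero_iff (N := N) _).2 ?_
    have := path (simplexPath ((TopCat.of X).toSSetObjEquiv _ s))
    unfold pathChain at this
    rw [pathSimplex_surjective] at this
    exact this
  have h' : k.hom a = 0 := by rw [h]; rfl
  exact (QuotientAddGroup.eq_zero_iff (N := N) a).1 h'

theorem oneChains_hom_ext {A : Type*} [AddCommGroup A] {f g : OneChains X →+ A}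
    (h : ∀ {x y : X} (γ : Path x y), f (pathChain γ) = g (pathChain γ)) : f = g :=
  AddMonoidHom.ext fun a => oneChains_induction (p := fun a => f a = g a) h (by simp)
    (fun a b ha hb => by simp [ha, hb]) (fun a ha => by simp [ha]) a

/-- The homomorphism on singular chains that is defined by its values on simplices. -/
def chainDesc {A : Type} [AddCommGroup A] {n : ℕ}
    (v : (TopCat.toSSet.obj (TopCat.of X)).obj (op (SimplexCategory.mk n)) → A) :
    (singularChains X).X n ⟶ ModuleCat.of ℤ A :=
  ((TopCat.toSSet.obj (TopCat.of X)).isColimitChainComplexXCofan (ModuleCat.of ℤ ℤ) n).desc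
    (Limits.Cofan.mk _ fun s => ModuleCat.ofHom ((LinearMap.id (R := ℤ) (M := ℤ)).smulRight (v s)))

theorem ι_chainDesc {A : Type} [AddCommGroup A] {n : ℕ}
    (v : (TopCat.toSSet.obj (TopCat.of X)).obj (op (SimplexCategory.mk n)) → A)
    (s : (TopCat.toSSet.obj (TopCat.of X)).obj (op (SimplexCategory.mk n))) :
    (TopCat.toSSet.obj (TopCat.of X)).ιChainComplex (R := ModuleCat.of ℤ ℤ) s ≫ chainDesc v =
      ModuleCat.ofHom ((LinearMap.id (R := ℤ) (M := ℤ)).smulRight (v s)) :=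
  ((TopCat.toSSet.obj (TopCat.of X)).isColimitChainComplexXCofan (ModuleCat.of ℤ ℤ) n).fac _ ⟨s⟩

/-- A function on paths, with values in an abelian group, that is additive under concatenation
and invariant under homotopy. -/
structure PathCocycle (X : Type) [TopologicalSpace X] (A : Type) [AddCommGroup A] where
  val : ∀ {x y : X}, Path x y → A
  homotopic : ∀ {x y : X} {γ γ' : Path x y}, γ.Homotopic γ' → val γ = val γ'
  trans : ∀ {x y z : X} (γ : Path x y) (γ' : Path y z), val (γ.trans γ') = val γ + val γ'

namespace PathCocycle

variable {A : Type} [AddCommGroup A] (c : PathCocycle X A)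

theorem val_congr {x y x' y' : X} {γ : Path x y} {γ' : Path x' y'}
    (h : ∀ t, γ t = γ' t) : c.val γ = c.val γ' := by
  obtain rfl : x = x' := by rw [← γ.source, h, γ'.source]
  obtain rfl : y = y' := by rw [← γ.target, h, γ'.target]
  rw [Path.ext (funext h)]

/-- The value on the path of a singular one-simplex. -/
def simplexVal (s : (TopCat.toSSet.obj (TopCat.of X)).obj (op (SimplexCategory.mk 1))) : A :=
  c.val (simplexPath ((TopCat.of X).toSSetObjEquiv _ s))

theorem simplexVal_pathSimplex {x y : X} (γ : Path x y) :
    c.simplexVal (pathSimplex γ) = c.val γ := by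
  refine c.val_congr fun t => ?_
  simp only [simplexPath, pathSimplex, Equiv.apply_symm_apply]
  rfl

instance : ContractibleSpace (stdSimplex ℝ (Fin 3)) :=
  (convex_stdSimplex ℝ (Fin 3)).contractibleSpace ⟨_, single_mem_stdSimplex ℝ 0⟩

/-- The triangle is contractible, so its edge from vertex 0 to vertex 2 is homotopic to the path
along the other two edges. This is the cocycle condition that lets `hom` descend modulo boundaries.
-/
theorem simplexVal_face
    (s : (TopCat.toSSet.obj (TopCat.of X)).obj (op (SimplexCategory.mk 2))) :
    c.simplexVal ((TopCat.toSSet.obj (TopCat.of X)).δ 1 s) =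
      c.simplexVal ((TopCat.toSSet.obj (TopCat.of X)).δ 2 s) +
        c.simplexVal ((TopCat.toSSet.obj (TopCat.of X)).δ 0 s) := by
  obtain ⟨K : C(stdSimplex ℝ (Fin 3), X), rfl⟩ := ((TopCat.of X).toSSetObjEquiv (op (SimplexCategory.mk 2))).symm.surjective s
  let edge (i : Fin 3) := simplexPath (X := stdSimplex ℝ (Fin 3))
    ⟨stdSimplex.map (SimplexCategory.δ i), stdSimplex.continuous_map _⟩
  have key (i : Fin 3) : c.simplexVal ((TopCat.toSSet.obj (TopCat.of X)).δ i
      (((TopCat.of X).toSSetObjEquiv (op (SimplexCategory.mk 2))).symm K)) =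
      c.val ((edge i).map K.continuous) := by
    rw [face_toSSetObjEquiv]
    exact c.val_congr fun t => rfl
  have vertex (i : Fin 3) (j : Fin 2) : stdSimplex.map (S := ℝ) (SimplexCategory.δ i)
      (stdSimplex.vertex j) = stdSimplex.vertex (i.succAbove j) := stdSimplex.map_vertex _ _
  let p₀₁ : Path (stdSimplex.vertex (S := ℝ) (0 : Fin 3)) (stdSimplex.vertex 1) :=
    (edge 2).cast (vertex 2 0).symm (vertex 2 1).symm
  let p₁₂ : Path (stdSimplex.vertex (S := ℝ) (1 : Fin 3)) (stdSimplex.vertex 2) :=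
    (edge 0).cast (vertex 0 0).symm (vertex 0 1).symm
  let p₀₂ : Path (stdSimplex.vertex (S := ℝ) (0 : Fin 3)) (stdSimplex.vertex 2) :=
    (edge 1).cast (vertex 1 0).symm (vertex 1 1).symm
  rw [key, key, key]
  calc c.val ((edge 1).map K.continuous) = c.val (p₀₂.map K.continuous) :=
        c.val_congr fun t => rfl
    _ = c.val ((p₀₁.trans p₁₂).map K.continuous) :=
        c.homotopic ((SimplyConnectedSpace.paths_homotopic _ _).map K)
    _ = c.val (p₀₁.map K.continuous) + c.val (p₁₂.map K.continuous) := by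
        rw [Path.map_trans, c.trans]
    _ = c.val ((edge 2).map K.continuous) + c.val ((edge 0).map K.continuous) :=
        congrArg₂ _ (c.val_congr fun t => rfl) (c.val_congr fun t => rfl)

/-- The homomorphism on one-chains modulo boundaries that is defined by a cocycle. -/
def hom : OneChains X →+ A :=
  ((singularChains X).descOpcycles (chainDesc c.simplexVal) 2 (by simp) (by
    refine SSet.chainComplex_hom_ext fun s => ?_
    rw [SSet.ιChainComplex_d_assoc, Fin.sum_univ_three, Limits.comp_zero]
    have h := c.simplexVal_face s
    simp only [Preadditive.add_comp, Preadditive.zsmul_comp, ι_chainDesc]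
    ext
    simp [h])).hom.toAddMonoidHom

theorem hom_pathChain {x y : X} (γ : Path x y) : c.hom (pathChain γ) = c.val γ := by
  rw [← c.simplexVal_pathSimplex]
  change ((singularChains X).descOpcycles _ 2 _ _).hom (((singularChains X).pOpcycles 1).hom
    (((TopCat.toSSet.obj (TopCat.of X)).ιChainComplex (R := ModuleCat.of ℤ ℤ)
      (pathSimplex γ)).hom 1)) = _
  rw [← LinearMap.comp_apply, ← ModuleCat.hom_comp, HomologicalComplex.p_descOpcycles,
    ← LinearMap.comp_apply, ← ModuleCat.hom_comp, ι_chainDesc]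
  simp

end PathCocycle

/-! ### Homology classes of loops -/

/-- The inclusion of the first homology into the one-chains modulo boundaries. -/
def H1ι (X : Type) [TopologicalSpace X] : H1 X →ₗ[ℤ] OneChains X :=
  ((singularChains X).homologyι 1).hom

theorem H1ι_injective : Function.Injective (H1ι X) :=
  (ModuleCat.mono_iff_injective ((singularChains X).homologyι 1)).1 inferInstance

theorem H1ι_loopClass {x : X} (γ : Path x x) : H1ι X (loopClass γ) = pathChain γ := by
  change (((singularChains X).liftCycles
    ((TopCat.toSSet.obj (TopCat.of X)).ιChainComplex (R := ModuleCat.of ℤ ℤ) (pathSimplex γ))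
      0 (ChainComplex.next_nat_succ 0) (pathSimplex_cycle γ) ≫ (singularChains X).homologyπ 1 ≫
      (singularChains X).homologyι 1).hom (1 : ℤ)) = _
  rw [HomologicalComplex.homology_π_ι, HomologicalComplex.liftCycles_i_assoc]
  rfl

/-- The endpoint map on one-chains: a path from `x` to `y` is mapped to `v y - v x`. -/
def endpointHom {A : Type} [AddCommGroup A] (v : X → A) : OneChains X →+ A :=
  ((singularChains X).fromOpcycles 1 0 ≫ chainDesc fun s =>
    v ((TopCat.of X).toSSetObjEquiv (op (SimplexCategory.mk 0)) s (stdSimplex.vertex 0))).hom.toAddMonoidHom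

theorem endpointHom_H1ι {A : Type} [AddCommGroup A] (v : X → A) (h : H1 X) :
    endpointHom v (H1ι X h) = 0 := by
  have : (singularChains X).homologyι 1 ≫ (singularChains X).fromOpcycles 1 0 = 0 := by simp
  change ((singularChains X).homologyι 1 ≫ (singularChains X).fromOpcycles 1 0 ≫ _).hom h = 0
  rw [reassoc_of% this, Limits.zero_comp]
  rfl

theorem endpointHom_pathChain {A : Type} [AddCommGroup A] (v : X → A) {x y : X} (γ : Path x y) :
    endpointHom v (pathChain γ) = v y - v x := by
  change ((((TopCat.toSSet.obj (TopCat.of X)).ιChainComplex (R := ModuleCat.of ℤ ℤ)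
    (pathSimplex γ)) ≫ (singularChains X).pOpcycles 1 ≫ (singularChains X).fromOpcycles 1 0 ≫
    chainDesc _).hom 1) = _
  rw [HomologicalComplex.p_fromOpcycles_assoc, SSet.ιChainComplex_d_assoc, Fin.sum_univ_two]
  simp only [Preadditive.add_comp, Preadditive.zsmul_comp, ι_chainDesc]
  have key (i : Fin 2) (s : I) (hs : stdSimplexHomeomorphUnitInterval (stdSimplex.map (SimplexCategory.δ i) (stdSimplex.vertex 0)) = s) :
    (TopCat.of X).toSSetObjEquiv (op (SimplexCategory.mk 0))
      ((TopCat.toSSet.obj (TopCat.of X)).δ i (pathSimplex γ)) (stdSimplex.vertex 0) = γ s := by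
    subst hs; rfl
  -- Face `0` omits vertex `0`, so it is the endpoint of the path; face `1` is the starting point.
  rw [key 0 1, key 1 0]
  · simp
    abel
  · erw [stdSimplex.map_vertex]; rfl
  · erw [stdSimplex.map_vertex]; rfl

/-- The map induced on one-chains modulo boundaries. -/
def oneChainsMap (f : C(X, Y)) : OneChains X →ₗ[ℤ] OneChains Y :=
  (HomologicalComplex.opcyclesMap
    (SSet.chainComplexMap (TopCat.toSSet.map (TopCat.ofHom f)) (ModuleCat.of ℤ ℤ)) 1).hom

theorem H1ι_H1map (f : C(X, Y)) (h : H1 X) : H1ι Y (H1map f h) = oneChainsMap f (H1ι X h) :=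
  congrArg (fun k => k.hom h) (HomologicalComplex.homologyι_naturality
    (SSet.chainComplexMap (TopCat.toSSet.map (TopCat.ofHom f)) (ModuleCat.of ℤ ℤ)) 1)

theorem oneChainsMap_pathChain (f : C(X, Y)) {x y : X} (γ : Path x y) :
    oneChainsMap f (pathChain γ) = pathChain (γ.map f.continuous) := by
  change ((TopCat.toSSet.obj (TopCat.of X)).ιChainComplex (R := ModuleCat.of ℤ ℤ) (pathSimplex γ) ≫
    (singularChains X).pOpcycles 1 ≫ HomologicalComplex.opcyclesMap
    (SSet.chainComplexMap (TopCat.toSSet.map (TopCat.ofHom f)) (ModuleCat.of ℤ ℤ)) 1).hom (1 : ℤ) = _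
  rw [HomologicalComplex.p_opcyclesMap, SSet.ι_chainComplexMap_f_assoc]
  rfl

theorem H1map_loopClass (f : C(X, Y)) {x : X} (γ : Path x x) :
    H1map f (loopClass γ) = loopClass (γ.map f.continuous) := by
  apply H1ι_injective
  rw [H1ι_H1map, H1ι_loopClass, oneChainsMap_pathChain, H1ι_loopClass]

theorem loopClass_eq_iff {x y : X} {γ : Path x x} {γ' : Path y y} :
    loopClass γ = loopClass γ' ↔ pathChain γ = pathChain γ' := by
  rw [← H1ι_loopClass, ← H1ι_loopClass, H1ι_injective.eq_iff]

theorem loopClass_trans {x : X} (γ γ' : Path x x) :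
    loopClass (γ.trans γ') = loopClass γ + loopClass γ' := by
  apply H1ι_injective
  simp [H1ι_loopClass, pathChain_trans]

theorem loopClass_refl (x : X) : loopClass (Path.refl x) = 0 := by
  apply H1ι_injective
  simp [H1ι_loopClass, pathChain_refl]

theorem loopClass_symm {x : X} (γ : Path x x) : loopClass γ.symm = -loopClass γ := by
  apply H1ι_injective
  simp [H1ι_loopClass, pathChain_symm]

theorem loopClass_conj {x y : X} (δ : Path x y) (γ : Path y y) :
    loopClass (δ.trans (γ.trans δ.symm)) = loopClass γ := by
  rw [loopClass_eq_iff, pathChain_trans, pathChain_trans, pathChain_symm]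
  abel

theorem loopClass_eq_of_homotopic {x : X} {γ γ' : Path x x} (h : γ.Homotopic γ') :
    loopClass γ = loopClass γ' :=
  loopClass_eq_iff.2 (pathChain_eq_of_homotopic h)

/-- The retraction of the one-chains onto the homology of a path-connected space that closes up
paths by chosen paths from the base point. -/
def closingCocycle [PathConnectedSpace X] (x₀ : X) : PathCocycle X (H1 X) where
  val {x y} γ := loopClass ((PathConnectedSpace.somePath x₀ x).trans
    (γ.trans (PathConnectedSpace.somePath x₀ y).symm))
  homotopic h := by
    rw [loopClass_eq_iff]
    simp only [pathChain_trans, pathChain_eq_of_homotopic h]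
  trans γ γ' := by
    apply H1ι_injective
    simp only [map_add, H1ι_loopClass, pathChain_trans, pathChain_symm]
    abel

/-- Closing up a path changes it by the difference of the chosen paths to its endpoints. Hence
closing up plus an endpoint map is the identity on chains, and endpoint maps vanish on cycles. -/
theorem closingCocycle_hom_H1ι [PathConnectedSpace X] (x₀ : X) (h : H1 X) :
    (closingCocycle x₀).hom (H1ι X h) = h := by
  apply H1ι_injective
  have key : (H1ι X).toAddMonoidHom.comp (closingCocycle x₀).hom +
      endpointHom (fun x => pathChain (PathConnectedSpace.somePath x₀ x)) = AddMonoidHom.id _ := by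
    refine oneChains_hom_ext fun γ => ?_
    change H1ι X ((closingCocycle x₀).hom _) + endpointHom _ _ = pathChain γ
    rw [PathCocycle.hom_pathChain, endpointHom_pathChain]
    change H1ι X (loopClass _) + _ = _
    simp only [H1ι_loopClass, pathChain_trans, pathChain_symm]
    abel
  have := DFunLike.congr_fun key (H1ι X h)
  rw [AddMonoidHom.add_apply, endpointHom_H1ι, add_zero] at this
  exact this

theorem loopClass_surjective [PathConnectedSpace X] (x₀ : X) (h : H1 X) :
    ∃ γ : Path x₀ x₀, loopClass γ = h := by
  rw [← closingCocycle_hom_H1ι x₀ h]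
  refine oneChains_induction (p := fun a => ∃ γ : Path x₀ x₀,
    loopClass γ = (closingCocycle x₀).hom a) (fun γ => ?_) ?_ ?_ ?_ (H1ι X h)
  · exact ⟨_, ((closingCocycle x₀).hom_pathChain γ).symm⟩
  · exact ⟨Path.refl x₀, by rw [loopClass_refl, map_zero]⟩
  · rintro a b ⟨γ, hγ⟩ ⟨γ', hγ'⟩
    exact ⟨γ.trans γ', by rw [loopClass_trans, hγ, hγ', map_add]⟩
  · rintro a ⟨γ, hγ⟩
    exact ⟨γ.symm, by rw [loopClass_symm, hγ, map_neg]⟩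

/-! ### Loops in the fundamental group and homomorphisms from it to abelian groups -/

/-- The class of a path in the fundamental groupoid. -/
def pathHom {x y : X} (γ : Path x y) : FundamentalGroupoid.mk x ⟶ FundamentalGroupoid.mk y :=
  Path.Homotopic.Quotient.mk γ

theorem pathHom_trans {x y z : X} (γ : Path x y) (γ' : Path y z) :
    pathHom (γ.trans γ') = pathHom γ ≫ pathHom γ' := rfl

theorem pathHom_symm {x y : X} (γ : Path x y) : pathHom γ.symm = inv (pathHom γ) := by
  rw [← Groupoid.inv_eq_inv]; rfl

theorem pathHom_eq_iff {x y : X} {γ γ' : Path x y} : pathHom γ = pathHom γ' ↔ γ.Homotopic γ' :=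
  Path.Homotopic.Quotient.eq

/-- The class of a loop in the fundamental group. -/
abbrev loopElt {x : X} (γ : Path x x) : FundamentalGroup X x :=
  FundamentalGroup.fromPath (Path.Homotopic.Quotient.mk γ)

/-- The product of the fundamental group is composition in the opposite order. This is the origin of
the reversed products and of the conjugations `x⁻¹ * z * x` below. -/
theorem loopElt_trans {x : X} (γ γ' : Path x x) :
    loopElt (γ.trans γ') = loopElt γ' * loopElt γ := rfl

theorem loopElt_symm {x : X} (γ : Path x x) : loopElt γ.symm = (loopElt γ)⁻¹ := rfl

theorem loopElt_refl (x : X) : loopElt (Path.refl x) = 1 := rfl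

theorem loopElt_eq_iff {x : X} {γ γ' : Path x x} : loopElt γ = loopElt γ' ↔ γ.Homotopic γ' :=
  Path.Homotopic.Quotient.eq

theorem exists_loopElt_eq {x : X} (a : FundamentalGroup X x) : ∃ γ : Path x x, loopElt γ = a :=
  Quotient.exists_rep a

section Descent

variable {A : Type} [AddCommGroup A] [PathConnectedSpace X] (x₀ : X)
  (φ : FundamentalGroup X x₀ →* Multiplicative A)

/-- The cocycle of a homomorphism from the fundamental group to an abelian group. -/
def homCocycle : PathCocycle X A where
  val {x y} γ := (φ (loopElt ((PathConnectedSpace.somePath x₀ x).trans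
    (γ.trans (PathConnectedSpace.somePath x₀ y).symm)))).toAdd
  homotopic h := by
    congr 2
    exact loopElt_eq_iff.2 (((Path.Homotopic.refl _).hcomp (h.hcomp (Path.Homotopic.refl _))))
  trans {x y z} γ γ' := by
    rw [add_comm, ← toAdd_mul, ← map_mul, ← loopElt_trans]
    congr 2
    rw [loopElt_eq_iff, ← pathHom_eq_iff]
    simp only [pathHom_trans, pathHom_symm, Category.assoc, IsIso.inv_hom_id_assoc]

/-- The homomorphism on first homology that is defined by a homomorphism from the fundamental
group to an abelian group. -/
def H1lift : H1 X →+ A :=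
  (homCocycle x₀ φ).hom.comp (H1ι X).toAddMonoidHom

theorem H1lift_loopClass (γ : Path x₀ x₀) :
    H1lift x₀ φ (loopClass γ) = (φ (loopElt γ)).toAdd := by
  change (homCocycle x₀ φ).hom (H1ι X (loopClass γ)) = _
  rw [H1ι_loopClass, PathCocycle.hom_pathChain]
  change (φ (loopElt _)).toAdd = _
  rw [loopElt_trans, loopElt_trans, loopElt_symm, map_mul φ, map_mul φ, map_inv φ,
    mul_comm, mul_inv_cancel_left]

end Descent

end PathChains

/-! ### The surface group -/

section SurfaceGroup

/-- The homomorphism from the surface group that is given by images of the generators such that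
the images of `a i` and `b i` commute. -/
def surfaceLift {g : ℕ} {H : Type*} [Group H] (f : Fin g ⊕ Fin g → H)
    (hf : ∀ i, Commute (f (Sum.inl i)) (f (Sum.inr i))) : SurfaceGroup g →* H :=
  PresentedGroup.toGroup (f := f) (by
    rintro _ rfl
    rw [surfaceRelator, map_list_prod, List.map_ofFn]
    apply List.prod_eq_one
    intro x hx
    obtain ⟨j, rfl⟩ := (List.mem_ofFn' _ _).1 hx
    simp [(hf j).eq])

theorem surfaceLift_of {g : ℕ} {H : Type*} [Group H] (f : Fin g ⊕ Fin g → H)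
    (hf : ∀ i, Commute (f (Sum.inl i)) (f (Sum.inr i))) (x : Fin g ⊕ Fin g) :
    surfaceLift f hf (PresentedGroup.of x) = f x :=
  PresentedGroup.toGroup.of _

theorem surfaceGroup_induction {g : ℕ} {p : SurfaceGroup g → Prop}
    (of : ∀ x, p (PresentedGroup.of x)) (one : p 1) (mul : ∀ x y, p x → p y → p (x * y))
    (inv : ∀ x, p x → p x⁻¹) (x : SurfaceGroup g) : p x := by
  have hx : x ∈ Subgroup.closure (Set.range (PresentedGroup.of (rels := {surfaceRelator g}))) := by
    rw [PresentedGroup.closure_range_of]; trivial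
  induction hx using Subgroup.closure_induction with
  | mem x hx => obtain ⟨y, rfl⟩ := hx; exact of y
  | one => exact one
  | mul x y _ _ hx hy => exact mul x y hx hy
  | inv x _ hx => exact inv x hx

theorem surfaceGroup_relation (r : ℕ) :
    (List.ofFn fun i : Fin r =>
      (PresentedGroup.of (Sum.inl i.castSucc) : SurfaceGroup (r + 1)) *
        PresentedGroup.of (Sum.inr i.castSucc) * (PresentedGroup.of (Sum.inl i.castSucc))⁻¹ *
        (PresentedGroup.of (Sum.inr i.castSucc))⁻¹).prod *
      (PresentedGroup.of (Sum.inl (Fin.last r)) * PresentedGroup.of (Sum.inr (Fin.last r)) *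
        (PresentedGroup.of (Sum.inl (Fin.last r)))⁻¹ *
        (PresentedGroup.of (Sum.inr (Fin.last r)))⁻¹) = 1 := by
  have h : PresentedGroup.mk {surfaceRelator (r + 1)} (List.ofFn fun i : Fin (r + 1) =>
      FreeGroup.of (Sum.inl i) * FreeGroup.of (Sum.inr i) * (FreeGroup.of (Sum.inl i))⁻¹ *
        (FreeGroup.of (Sum.inr i))⁻¹).prod = 1 :=
    PresentedGroup.one_of_mem rfl
  rw [map_list_prod, List.map_ofFn, List.ofFn_succ', List.prod_concat] at h
  exact h

/-- The algebraic intersection number with `a_g`. -/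
def crossingNumber {r : ℕ} (x : SurfaceGroup (r + 1)) : ℤ :=
  (intersectionWithA (Fin.last r) x).toAdd

section CrossingNumber

variable {r : ℕ}

theorem crossingNumber_mul (x y : SurfaceGroup (r + 1)) :
    crossingNumber (x * y) = crossingNumber x + crossingNumber y := by
  simp [crossingNumber]

theorem crossingNumber_one : crossingNumber (1 : SurfaceGroup (r + 1)) = 0 := by
  simp [crossingNumber]

theorem crossingNumber_inv (x : SurfaceGroup (r + 1)) :
    crossingNumber x⁻¹ = -crossingNumber x := by
  simp [crossingNumber]

theorem crossingNumber_zpow (x : SurfaceGroup (r + 1)) (k : ℤ) :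
    crossingNumber (x ^ k) = k * crossingNumber x := by
  simp [crossingNumber]

theorem crossingNumber_inl (i : Fin (r + 1)) :
    crossingNumber (PresentedGroup.of (Sum.inl i) : SurfaceGroup (r + 1)) = 0 := by
  rw [crossingNumber, intersectionWithA, PresentedGroup.toGroup.of]
  rfl

theorem crossingNumber_inr (i : Fin (r + 1)) :
    crossingNumber (PresentedGroup.of (Sum.inr i) : SurfaceGroup (r + 1)) =
      if i = Fin.last r then 1 else 0 := by
  rw [crossingNumber, intersectionWithA, PresentedGroup.toGroup.of]
  simp only [Sum.elim_inr]
  split_ifs <;> rfl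

/-- The generators `a i`, `b i` for `i < g`. -/
def sideGen (j : Fin r ⊕ Fin r) : SurfaceGroup (r + 1) :=
  PresentedGroup.of (Sum.map Fin.castSucc Fin.castSucc j)

/-- The generator `b_g`. -/
def crossGen (r : ℕ) : SurfaceGroup (r + 1) := PresentedGroup.of (Sum.inr (Fin.last r))

/-- The generator `a_g`. -/
def coreGen (r : ℕ) : SurfaceGroup (r + 1) := PresentedGroup.of (Sum.inl (Fin.last r))

theorem crossingNumber_sideGen (j : Fin r ⊕ Fin r) : crossingNumber (sideGen j) = 0 := by
  rcases j with i | i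
  · exact crossingNumber_inl _
  · exact (crossingNumber_inr _).trans (if_neg (Fin.castSucc_ne_last i))

theorem crossingNumber_crossGen : crossingNumber (crossGen r) = 1 :=
  (crossingNumber_inr _).trans (if_pos rfl)

theorem crossingNumber_coreGen : crossingNumber (coreGen r) = 0 := crossingNumber_inl _

theorem surfaceGroup_induction_gens {p : SurfaceGroup (r + 1) → Prop}
    (side : ∀ j, p (sideGen j)) (core : p (coreGen r)) (cross : p (crossGen r)) (one : p 1)
    (mul : ∀ x y, p x → p y → p (x * y)) (inv : ∀ x, p x → p x⁻¹) (x : SurfaceGroup (r + 1)) :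
    p x := by
  refine surfaceGroup_induction ?_ one mul inv x
  rintro (i | i)
  · induction i using Fin.lastCases with
    | last => exact core
    | cast i => exact side (Sum.inl i)
  · induction i using Fin.lastCases with
    | last => exact cross
    | cast i => exact side (Sum.inr i)

/-- A subgroup that contains all generators except `b_g`, the power `b_g ^ q`, and is normalized
by `b_g` contains all elements whose intersection number with `a_g` is divisible by `q`. -/
theorem mem_of_dvd_crossingNumber {q : ℕ} (H : Subgroup (SurfaceGroup (r + 1)))
    (side : ∀ j, sideGen j ∈ H) (core : coreGen r ∈ H) (cross : crossGen r ^ q ∈ H)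
    (conj : ∀ (k : ℤ), ∀ x ∈ H, crossGen r ^ k * x * (crossGen r ^ k)⁻¹ ∈ H)
    {x : SurfaceGroup (r + 1)} (hx : (q : ℤ) ∣ crossingNumber x) : x ∈ H := by
  -- Modulo `H`, every element is the power of `b_g` that its intersection number prescribes; this
  -- is stable under products because `H` is normalized by `b_g`.
  have key : x * (crossGen r ^ crossingNumber x)⁻¹ ∈ H := by
    refine surfaceGroup_induction_gens
      (p := fun x => x * (crossGen r ^ crossingNumber x)⁻¹ ∈ H) ?_ ?_ ?_ ?_ ?_ ?_ x
    · intro j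
      simpa [crossingNumber_sideGen] using side j
    · simpa [crossingNumber_coreGen] using core
    · simp [crossingNumber_crossGen, H.one_mem]
    · simp [crossingNumber_one, H.one_mem]
    · intro x y hx hy
      have h := H.mul_mem hx (conj (crossingNumber x) _ hy)
      rw [crossingNumber_mul, zpow_add]
      convert h using 1
      group
    · intro x hx
      have h := conj (-crossingNumber x) _ (H.inv_mem hx)
      rw [crossingNumber_inv]
      convert h using 1
      group
  obtain ⟨k, hk⟩ := hx
  have h : crossGen r ^ crossingNumber x ∈ H := by
    rw [hk, zpow_mul, zpow_natCast]
    exact H.zpow_mem cross k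
  simpa using H.mul_mem key h

end CrossingNumber

/-! ### Fox derivatives -/

section Fox

variable {r : ℕ} {R : Type*} [Ring R] (u : Rˣ)

/-- The affine action of the generators that defines the Fox derivatives. -/
def foxGen : Fin (r + 1) ⊕ Fin (r + 1) → Equiv.Perm (Fin r ⊕ Fin r → R) :=
  Sum.elim
    (Fin.lastCases 1 fun i => Equiv.addRight (Pi.single (Sum.inl i) 1))
    (Fin.lastCases (MulAction.toPerm u⁻¹) fun i => Equiv.addRight (Pi.single (Sum.inr i) 1))

/-- The affine action of the surface group that defines the Fox derivatives. -/
def foxAction : SurfaceGroup (r + 1) →* Equiv.Perm (Fin r ⊕ Fin r → R) :=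
  surfaceLift (foxGen u) (by
    intro i
    induction i using Fin.lastCases with
    | last => simp [foxGen]
    | cast i =>
      refine Equiv.ext fun v => ?_
      simp [foxGen, add_right_comm])

/-- The vector of the Fox derivatives with respect to `a i`, `b i` for `i < g`. -/
def fox (x : SurfaceGroup (r + 1)) : Fin r ⊕ Fin r → R := foxAction u x 0

/-- The generators with `i < g` act by translations, `a_g` trivially and `b_g` by the scalar `u⁻¹`.
So every element acts by an affine map with scalar linear part, and `fox` is its translation part.
-/
theorem foxAction_apply (x : SurfaceGroup (r + 1)) (v : Fin r ⊕ Fin r → R) :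
    foxAction u x v = u ^ (-crossingNumber x) • v + fox u x := by
  revert v
  refine surfaceGroup_induction_gens (p := fun x => ∀ v,
    foxAction u x v = u ^ (-crossingNumber x) • v + fox u x) ?_ ?_ ?_ ?_ ?_ ?_ x
  · rintro (i | i) v
    all_goals
      rw [crossingNumber_sideGen, fox, sideGen, foxAction, surfaceLift_of]
      simp [foxGen]
  · intro v
    rw [crossingNumber_coreGen, fox, coreGen, foxAction, surfaceLift_of]
    simp [foxGen]
  · intro v
    rw [crossingNumber_crossGen, fox, crossGen, foxAction, surfaceLift_of]
    simp [foxGen]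
  · intro v
    simp [crossingNumber_one, fox]
  · intro x y hx hy v
    have h : fox u (x * y) = u ^ (-crossingNumber x) • fox u y + fox u x := by
      rw [← hx, fox, map_mul]; rfl
    rw [map_mul, Equiv.Perm.mul_apply, hy, hx, h, crossingNumber_mul, neg_add, zpow_add,
      smul_add, smul_smul, add_assoc]
  · intro x hx v
    have h : u ^ (-crossingNumber x) • fox u x⁻¹ + fox u x = 0 := by
      rw [← hx, fox, map_inv, ← Equiv.Perm.mul_apply, mul_inv_cancel]; rfl
    rw [map_inv, Equiv.Perm.inv_eq_iff_eq, hx, smul_add, add_assoc, h, smul_smul, ← zpow_add,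
      crossingNumber_inv]
    simp

theorem fox_mul (x y : SurfaceGroup (r + 1)) :
    fox u (x * y) = fox u x + u ^ (-crossingNumber x) • fox u y := by
  rw [add_comm (fox u x), ← foxAction_apply, fox, map_mul]
  rfl

theorem fox_one : fox u (1 : SurfaceGroup (r + 1)) = 0 := by
  simp [fox]

theorem fox_inv_add (x : SurfaceGroup (r + 1)) :
    fox u x⁻¹ + u ^ crossingNumber x • fox u x = 0 := by
  have h := fox_mul u x⁻¹ x
  rw [inv_mul_cancel, fox_one, crossingNumber_inv, neg_neg] at h
  exact h.symm

theorem fox_inv (x : SurfaceGroup (r + 1)) :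
    fox u x⁻¹ = -(u ^ crossingNumber x • fox u x) :=
  eq_neg_of_add_eq_zero_left (fox_inv_add u x)

/-- An affine map with trivial linear part is a translation, and conjugation only rescales its
vector. This governs every change of base point, of path and of representative. -/
theorem fox_conj (x z : SurfaceGroup (r + 1)) (hz : u ^ crossingNumber z = 1) :
    fox u (x⁻¹ * z * x) = u ^ crossingNumber x • fox u z := by
  rw [mul_assoc, fox_mul, fox_mul, zpow_neg u (crossingNumber z), hz, inv_one, one_smul,
    crossingNumber_inv, neg_neg, smul_add, add_left_comm, fox_inv_add, add_zero]

theorem fox_sideGen (j : Fin r ⊕ Fin r) : fox u (sideGen j) = Pi.single j 1 := by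
  rw [fox, foxAction, sideGen, surfaceLift_of]
  rcases j with i | i <;> simp [foxGen]

theorem fox_coreGen : fox u (coreGen r) = 0 := by
  rw [fox, foxAction, coreGen, surfaceLift_of]
  simp [foxGen]

theorem fox_crossGen : fox u (crossGen r) = 0 := by
  rw [fox, foxAction, crossGen, surfaceLift_of]
  simp [foxGen]

/-- Naturality in the coefficients: a computation over `ℤ[t,t⁻¹]` specializes to the group ring of
every deck group. -/
theorem map_fox {R' : Type*} [Ring R'] (ψ : R →+* R') (x : SurfaceGroup (r + 1))
    (j : Fin r ⊕ Fin r) : ψ (fox u x j) = fox (Units.map ψ.toMonoidHom u) x j := by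
  revert j
  refine surfaceGroup_induction_gens (p := fun x => ∀ j, ψ (fox u x j) =
    fox (Units.map ψ.toMonoidHom u) x j) ?_ ?_ ?_ ?_ ?_ ?_ x
  · intro i j
    rw [fox_sideGen, fox_sideGen]
    by_cases h : j = i
    · subst h; simp
    · simp [h]
  · intro j
    simp [fox_coreGen]
  · intro j
    simp [fox_crossGen]
  · intro j
    simp [fox_one]
  · intro x y hx hy j
    simp only [fox_mul, Pi.add_apply, map_add, hx, Pi.smul_apply, Units.smul_def, smul_eq_mul,
      map_mul, hy]
    congr 2
    rw [← map_zpow]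
    rfl
  · intro x hx j
    simp only [fox_inv, Pi.neg_apply, map_neg, hx,
      Pi.smul_apply, Units.smul_def, smul_eq_mul, map_mul]
    congr 2
    rw [← map_zpow]
    rfl

end Fox

end SurfaceGroup

/-! ### Intersection numbers of paths -/

namespace PathCocycle

variable {X Y : Type} [TopologicalSpace X] [TopologicalSpace Y] {A : Type} [AddCommGroup A]
  (c : PathCocycle X A)

theorem val_refl (x : X) : c.val (Path.refl x) = 0 := by
  rw [← hom_pathChain, pathChain_refl, map_zero]

theorem val_symm {x y : X} (γ : Path x y) : c.val γ.symm = -c.val γ := by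
  rw [← hom_pathChain, pathChain_symm, map_neg, hom_pathChain]

theorem val_cast {x y x' y' : X} (γ : Path x y) (hx : x' = x) (hy : y' = y) :
    c.val (γ.cast hx hy) = c.val γ :=
  c.val_congr fun _ => rfl

theorem val_eq_of_loopClass_eq {x y : X} {γ : Path x x} {γ' : Path y y}
    (h : loopClass γ = loopClass γ') : c.val γ = c.val γ' := by
  rw [← hom_pathChain, ← hom_pathChain, loopClass_eq_iff.1 h]

/-- The pull-back of a cocycle by a continuous map. -/
def comap (f : C(Y, X)) : PathCocycle Y A where
  val γ := c.val (γ.map f.continuous)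
  homotopic h := c.homotopic (h.map f)
  trans γ γ' := by rw [Path.map_trans, c.trans]

end PathCocycle

theorem homCocycle_val_loop {X : Type} [TopologicalSpace X] [PathConnectedSpace X]
    {A : Type} [AddCommGroup A] (x₀ : X) (φ : FundamentalGroup X x₀ →* Multiplicative A)
    (γ : Path x₀ x₀) : (homCocycle x₀ φ).val γ = (φ (loopElt γ)).toAdd := by
  rw [← H1lift_loopClass, ← PathCocycle.hom_pathChain, ← H1ι_loopClass]
  rfl

namespace StandardSystem

variable {r : ℕ} {S : Type} [TopologicalSpace S] (m : StandardSystem (r + 1) S)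

/-- The element of the surface group that is represented by a loop. -/
def elt (γ : Path m.base m.base) : SurfaceGroup (r + 1) := m.iso.symm (loopElt γ)

theorem elt_trans (γ γ' : Path m.base m.base) : m.elt (γ.trans γ') = m.elt γ' * m.elt γ := by
  rw [elt, loopElt_trans, map_mul]; rfl

theorem elt_symm (γ : Path m.base m.base) : m.elt γ.symm = (m.elt γ)⁻¹ := by
  rw [elt, loopElt_symm, map_inv]; rfl

theorem elt_refl : m.elt (Path.refl m.base) = 1 := by
  rw [elt, loopElt_refl, map_one]

theorem elt_conj (δ γ : Path m.base m.base) :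
    m.elt (δ.trans (γ.trans δ.symm)) = (m.elt δ)⁻¹ * m.elt γ * m.elt δ := by
  rw [elt_trans, elt_trans, elt_symm]

theorem elt_eq_iff {γ γ' : Path m.base m.base} : m.elt γ = m.elt γ' ↔ γ.Homotopic γ' := by
  rw [elt, elt, m.iso.symm.injective.eq_iff, loopElt_eq_iff]

theorem exists_elt_eq (x : SurfaceGroup (r + 1)) : ∃ γ, m.elt γ = x := by
  obtain ⟨γ, hγ⟩ := exists_loopElt_eq (m.iso x)
  exact ⟨γ, by rw [elt, hγ, MulEquiv.symm_apply_apply]⟩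

theorem elt_α (i : Fin (r + 1)) : m.elt (m.α i) = PresentedGroup.of (Sum.inl i) := by
  rw [elt, MulEquiv.symm_apply_eq, m.iso_a]

theorem elt_β (i : Fin (r + 1)) : m.elt (m.β i) = PresentedGroup.of (Sum.inr i) := by
  rw [elt, MulEquiv.symm_apply_eq, m.iso_b]

/-- The loops `α i`, `β i` for `i < g`. -/
def sideLoop (j : Fin r ⊕ Fin r) : Path m.base m.base :=
  Sum.elim (fun i => m.α i.castSucc) (fun i => m.β i.castSucc) j

theorem elt_sideLoop (j : Fin r ⊕ Fin r) : m.elt (m.sideLoop j) = sideGen j := by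
  rcases j with i | i
  · exact m.elt_α _
  · exact m.elt_β _

variable [PathConnectedSpace S]

/-- The homomorphism from the first homology of the surface that is defined by a homomorphism
from the surface group. -/
def homologyHom {A : Type} [AddCommGroup A] (h : SurfaceGroup (r + 1) →* Multiplicative A) :
    H1 S →+ A :=
  H1lift m.base (h.comp m.iso.symm.toMonoidHom)

theorem homologyHom_loopClass {A : Type} [AddCommGroup A]
    (h : SurfaceGroup (r + 1) →* Multiplicative A) (γ : Path m.base m.base) :
    m.homologyHom h (loopClass γ) = (h (m.elt γ)).toAdd :=
  H1lift_loopClass _ _ _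

/-- The algebraic intersection number with `a_g`, as a cocycle. -/
def crossing : PathCocycle S ℤ :=
  homCocycle m.base ((intersectionWithA (Fin.last r)).comp m.iso.symm.toMonoidHom)

theorem crossing_loop (γ : Path m.base m.base) :
    m.crossing.val γ = crossingNumber (m.elt γ) :=
  homCocycle_val_loop _ _ _

/-- A homeomorphism preserves the intersection numbers of loops with `a_g`. -/
def PreservesCrossing (f : S ≃ₜ S) : Prop :=
  ∀ {x : S} (γ : Path x x), m.crossing.val (γ.map f.continuous) = m.crossing.val γ

theorem preservesCrossing_of_H1map {f : S ≃ₜ S} (hf : H1map (homeoMap f) = LinearMap.id) :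
    m.PreservesCrossing f := fun γ =>
  m.crossing.val_eq_of_loopClass_eq (by
    have h := H1map_loopClass (homeoMap f) γ
    rw [hf] at h
    exact h.symm)

theorem preservesCrossing_one : m.PreservesCrossing 1 := fun _ =>
  m.crossing.val_congr fun _ => rfl

theorem PreservesCrossing.inv {m : StandardSystem (r + 1) S} {f : S ≃ₜ S}
    (hf : m.PreservesCrossing f) : m.PreservesCrossing f⁻¹ := fun {x} γ => by
  rw [← hf (γ.map (f⁻¹).continuous)]
  exact m.crossing.val_congr fun t => f.apply_symm_apply _

theorem PreservesCrossing.map_path {m : StandardSystem (r + 1) S} {f : S ≃ₜ S}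
    (hf : m.PreservesCrossing f) {x y : S} (h : x = y) (γ : Path x y) :
    m.crossing.val (γ.map f.continuous) = m.crossing.val γ := by
  subst h; exact hf γ

end StandardSystem

/-! ### Paths and deck transformations of cyclic covers -/

namespace CyclicCover

variable {r : ℕ} {S : Type} [TopologicalSpace S]
  {m : StandardSystem (r + 1) S} {q : ℕ} {X : Type} [TopologicalSpace X] (c : CyclicCover m q X)

/-- The projection of a path between points above the base point. -/
def down {x y : X} (γ : Path x y) (hx : c.proj x = m.base) (hy : c.proj y = m.base) :
    Path m.base m.base :=
  (γ.map c.proj.continuous).cast hx.symm hy.symm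

theorem elt_down_trans {x y z : X} (γ : Path x y) (γ' : Path y z) (hx : c.proj x = m.base)
    (hy : c.proj y = m.base) (hz : c.proj z = m.base) :
    m.elt (c.down (γ.trans γ') hx hz) = m.elt (c.down γ' hy hz) * m.elt (c.down γ hx hy) := by
  rw [← m.elt_trans, down, Path.map_trans]
  rfl

theorem elt_down_symm {x y : X} (γ : Path x y) (hx : c.proj x = m.base)
    (hy : c.proj y = m.base) : m.elt (c.down γ.symm hy hx) = (m.elt (c.down γ hx hy))⁻¹ := by
  rw [← m.elt_symm]
  rfl

theorem homotopic_of_elt_down_eq {x y : X} {γ γ' : Path x y} {hx : c.proj x = m.base}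
    {hy : c.proj y = m.base} (h : m.elt (c.down γ hx hy) = m.elt (c.down γ' hx hy)) :
    γ.Homotopic γ' := by
  have h' := (m.elt_eq_iff.1 h).pathCast hx hy
  have := c.isCoveringMap.injective_path_homotopic_map x y (a₁ := .mk γ) (a₂ := .mk γ')
    (Path.Homotopic.Quotient.eq.2 h')
  exact Path.Homotopic.Quotient.eq.1 this

theorem exists_down_homotopic (x : SurfaceGroup (r + 1)) (hx : (q : ℤ) ∣ crossingNumber x) :
    ∃ γ : Path c.base c.base, m.elt (c.down γ c.proj_base c.proj_base) = x := by
  have h := (c.mem_range_iff (m.iso x)).2 (by rwa [MulEquiv.symm_apply_apply])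
  obtain ⟨a, ha⟩ := h
  obtain ⟨γ, rfl⟩ := exists_loopElt_eq a
  refine ⟨γ, ?_⟩
  rw [StandardSystem.elt, MulEquiv.symm_apply_eq, ← ha, FundamentalGroup.mapOfEq_apply]
  rfl

theorem dvd_crossingNumber_down (γ : Path c.base c.base) :
    (q : ℤ) ∣ crossingNumber (m.elt (c.down γ c.proj_base c.proj_base)) := by
  refine (c.mem_range_iff (loopElt (c.down γ c.proj_base c.proj_base))).1 ⟨loopElt γ, ?_⟩
  rw [FundamentalGroup.mapOfEq_apply]
  rfl

theorem endpoint_eq {x y y' : X} (δ : Path x y) (δ' : Path x y') (h : c.proj y = c.proj y')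
    (hδ : ((δ'.map c.proj.continuous).cast rfl h).Homotopic (δ.map c.proj.continuous)) :
    y = y' := by
  have h₁ := c.isCoveringMap.monodromy_map (.mk δ)
  have h₂ := c.isCoveringMap.monodromy_eq_of_map_eq (γ := .mk (δ.map c.proj.continuous))
    (ex := ⟨x, rfl⟩) (ey := ⟨y', h.symm⟩) (.mk δ') (by
      exact Path.Homotopic.Quotient.eq.2 (hδ.pathCast rfl h.symm))
  exact congrArg Subtype.val (h₁.symm.trans h₂)

theorem exists_lift_path {x : X} {z : S} (γ : Path (c.proj x) z) :
    ∃ (y : X) (_ : c.proj y = z) (δ : Path x y), ∀ t, c.proj (δ t) = γ t := by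
  have h := c.isCoveringMap.liftPath_lifts γ.toContinuousMap x γ.source
  have key (t : I) : c.proj (c.isCoveringMap.liftPath γ.toContinuousMap x γ.source t) = γ t :=
    congrFun h t
  refine ⟨_, (key 1).trans γ.target, ⟨c.isCoveringMap.liftPath γ.toContinuousMap x γ.source,
    c.isCoveringMap.liftPath_zero _ _ _, rfl⟩, key⟩

theorem locallyPathConnectedSpace [LocallyPathConnectedSpace S] (c : CyclicCover m q X) :
    LocallyPathConnectedSpace X :=
  letI : ChartedSpace S X :=
    { atlas := Set.univ
      chartAt := fun x => (c.isCoveringMap.isLocalHomeomorph x).choose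
      mem_chart_source := fun x => (c.isCoveringMap.isLocalHomeomorph x).choose_spec.1
      chart_mem_atlas := fun _ => trivial }
  ChartedSpace.locallyPathConnectedSpace S X

theorem lift_eq {F F' : C(X, X)} {f : S → S} (hF : ∀ z, c.proj (F z) = f (c.proj z))
    (hF' : ∀ z, c.proj (F' z) = f (c.proj z)) {x : X} (h : F x = F' x) : F = F' := by
  have := c.pathConnected
  exact DFunLike.coe_injective (c.isCoveringMap.eq_of_comp_eq F.continuous F'.continuous
    (funext fun z => (hF z).trans (hF' z).symm) x h)

variable {c} in
theorem deck_ext {d d' : c.Deck} {x : X} (h : (d : X ≃ₜ X) x = (d' : X ≃ₜ X) x) : d = d' := by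
  have := c.lift_eq (F := homeoMap (d : X ≃ₜ X)) (F' := homeoMap (d' : X ≃ₜ X)) (f := id)
    d.2 d'.2 h
  exact Subtype.ext (Homeomorph.ext fun x => DFunLike.congr_fun this x)

section Degree

variable [PathConnectedSpace S]

/-- The algebraic intersection number with `a_g` of paths in the cover. -/
def degree : PathCocycle X ℤ := m.crossing.comap c.proj

theorem degree_eq_crossingNumber {x y : X} (γ : Path x y) (hx : c.proj x = m.base)
    (hy : c.proj y = m.base) : c.degree.val γ = crossingNumber (m.elt (c.down γ hx hy)) := by
  rw [← m.crossing_loop]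
  exact m.crossing.val_congr fun _ => rfl

theorem dvd_degree_loop {x : X} (γ : Path x x) : (q : ℤ) ∣ c.degree.val γ := by
  have := c.pathConnected
  have h := c.dvd_crossingNumber_down
    ((PathConnectedSpace.somePath c.base x).trans
      (γ.trans (PathConnectedSpace.somePath c.base x).symm))
  rw [← c.degree_eq_crossingNumber] at h
  rwa [c.degree.val_eq_of_loopClass_eq (loopClass_conj _ γ)] at h

/-- Conjugated to the base point, the projection of `δ` is a loop with intersection number divisible
by `q`, so it lifts to a closed loop. By uniqueness of lifts, `δ` closes up as well. -/
theorem eq_of_dvd_degree {x y : X} (δ : Path x y) (h : c.proj x = c.proj y)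
    (hδ : (q : ℤ) ∣ c.degree.val δ) : x = y := by
  have := c.pathConnected
  let η := PathConnectedSpace.somePath c.base x
  let ηS := (η.map c.proj.continuous).cast c.proj_base.symm rfl
  let δS := (δ.map c.proj.continuous).cast rfl h
  have hcr : crossingNumber (m.elt (ηS.trans (δS.trans ηS.symm))) = c.degree.val δ := by
    rw [← m.crossing_loop, m.crossing.val_eq_of_loopClass_eq (loopClass_conj _ _)]
    exact m.crossing.val_cast _ _ _
  obtain ⟨γ, hγ⟩ := c.exists_down_homotopic _ (hcr ▸ hδ)
  have hγ' := m.elt_eq_iff.1 hγ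
  symm
  refine c.endpoint_eq δ (η.symm.trans (γ.trans η)) h.symm ?_
  have e : ((η.symm.trans (γ.trans η)).map c.proj.continuous) =
      ηS.symm.trans ((c.down γ c.proj_base c.proj_base).trans ηS) := by
    rw [Path.map_trans, Path.map_trans]
    rfl
  have e' : (ηS.symm.trans ((c.down γ c.proj_base c.proj_base).trans ηS)).Homotopic δS := by
    rw [← pathHom_eq_iff] at hγ' ⊢
    simp only [pathHom_trans, pathHom_symm] at hγ' ⊢
    rw [hγ']
    simp
  rw [e]
  exact e'.pathCast rfl h.symm

/-! ### Lifts of homeomorphisms -/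

theorem exists_continuous_lift [LocallyPathConnectedSpace S] {f : S ≃ₜ S}
    (hf : m.PreservesCrossing f) {x y : X} (h : c.proj y = f (c.proj x)) :
    ∃ F : C(X, X), F x = y ∧ ∀ z, c.proj (F z) = f (c.proj z) := by
  have := c.pathConnected
  have := c.locallyPathConnectedSpace
  obtain ⟨F, ⟨hF, hF'⟩, -⟩ := c.isCoveringMap.existsUnique_continuousMap_lifts_of_range_le
    (f := (homeoMap f).comp c.proj) (a₀ := x) (e₀ := y) h (by
      rintro _ ⟨a, rfl⟩
      obtain ⟨γ, rfl⟩ := exists_loopElt_eq a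
      obtain ⟨y', hy', δ, hδ⟩ := c.exists_lift_path
        (((γ.map c.proj.continuous).map f.continuous).cast h h)
      -- The lifting criterion: the image of a loop of the cover lifts to a closed path, because its
      -- intersection number with `a_g` is unchanged by `f`.
      have hd : (q : ℤ) ∣ c.degree.val δ := by
        have e : c.degree.val δ = c.degree.val γ :=
          (m.crossing.val_congr hδ).trans (hf (γ.map c.proj.continuous))
        rw [e]
        exact c.dvd_degree_loop γ
      obtain rfl := c.eq_of_dvd_degree δ hy'.symm hd
      refine ⟨loopElt δ, ?_⟩
      rw [FundamentalGroup.mapOfEq_apply]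
      refine congrArg Path.Homotopic.Quotient.mk (Path.ext (funext fun t => hδ t)))
  exact ⟨F, hF, congrFun hF'⟩

theorem exists_homeomorph_lift [LocallyPathConnectedSpace S] {f : S ≃ₜ S}
    (hf : m.PreservesCrossing f) {x y : X} (h : c.proj y = f (c.proj x)) :
    ∃ F : X ≃ₜ X, F x = y ∧ ∀ z, c.proj (F z) = f (c.proj z) := by
  obtain ⟨F, hFx, hF⟩ := c.exists_continuous_lift hf h
  obtain ⟨G, hGy, hG⟩ := c.exists_continuous_lift hf.inv (x := y) (y := x)
    (by rw [h]; exact (f.symm_apply_apply _).symm)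
  have h₁ : G.comp F = ContinuousMap.id X := by
    refine c.lift_eq (f := id) (x := x) (fun z => ?_) (fun z => rfl) ?_
    · rw [ContinuousMap.comp_apply, hG, hF]
      exact f.symm_apply_apply _
    · rw [ContinuousMap.comp_apply, hFx, hGy]; rfl
  have h₂ : F.comp G = ContinuousMap.id X := by
    refine c.lift_eq (f := id) (x := y) (fun z => ?_) (fun z => rfl) ?_
    · rw [ContinuousMap.comp_apply, hF, hG]
      exact f.apply_symm_apply _
    · rw [ContinuousMap.comp_apply, hGy, hFx]; rfl
  exact ⟨⟨⟨F, G, DFunLike.congr_fun h₁, DFunLike.congr_fun h₂⟩, F.continuous, G.continuous⟩, hFx,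
    hF⟩

/-! ### The degree of a deck transformation -/

/-- The deck transformation `d` has degree `k` modulo `q`. -/
def HasDegree (d : c.Deck) (k : ℤ) : Prop :=
  ∃ (x y : X) (δ : Path x y), (d : X ≃ₜ X) x = y ∧ (q : ℤ) ∣ c.degree.val δ - k

variable {c}

theorem degree_map_deck (d : c.Deck) {x y : X} (γ : Path x y) :
    c.degree.val (γ.map (d : X ≃ₜ X).continuous) = c.degree.val γ :=
  m.crossing.val_congr fun t => d.2 (γ t)

theorem HasDegree.dvd {d : c.Deck} {k : ℤ} (h : c.HasDegree d k) {x y : X}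
    (δ : Path x y) (hy : (d : X ≃ₜ X) x = y) : (q : ℤ) ∣ c.degree.val δ - k := by
  subst hy
  obtain ⟨y, _, δ', rfl, b, hb⟩ := h
  have := c.pathConnected
  let η := PathConnectedSpace.somePath x y
  -- In the quadrilateral with sides `δ`, `d η`, `δ'` and `η`, the degrees of `η` and of its
  -- translate cancel, so `δ` and `δ'` have the same degree modulo `q`.
  obtain ⟨a, ha⟩ := c.dvd_degree_loop
    (δ.trans ((η.map (d : X ≃ₜ X).continuous).trans (δ'.symm.trans η.symm)))
  rw [PathCocycle.trans, PathCocycle.trans, PathCocycle.trans, PathCocycle.val_symm,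
    PathCocycle.val_symm, degree_map_deck] at ha
  exact ⟨a + b, by linear_combination ha + hb⟩

theorem HasDegree.eq {d d' : c.Deck} {k : ℤ} (h : c.HasDegree d k) (h' : c.HasDegree d' k) :
    d = d' := by
  have := c.pathConnected
  let δ := PathConnectedSpace.somePath c.base ((d : X ≃ₜ X) c.base)
  let δ' := PathConnectedSpace.somePath c.base ((d' : X ≃ₜ X) c.base)
  refine deck_ext (x := c.base) (c.eq_of_dvd_degree (δ.symm.trans δ') ?_ ?_)
  · rw [d.2, d'.2]
  · rw [PathCocycle.trans, PathCocycle.val_symm]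
    obtain ⟨a, ha⟩ := h.dvd δ rfl
    obtain ⟨b, hb⟩ := h'.dvd δ' rfl
    exact ⟨b - a, by linear_combination hb - ha⟩

theorem HasDegree.congr {d : c.Deck} {k k' : ℤ} (h : c.HasDegree d k) (hk : (q : ℤ) ∣ k - k') :
    c.HasDegree d k' := by
  obtain ⟨x, y, δ, hy, a, ha⟩ := h
  obtain ⟨b, hb⟩ := hk
  exact ⟨x, y, δ, hy, a + b, by linear_combination ha + hb⟩

theorem HasDegree.mul {d d' : c.Deck} {k k' : ℤ} (h : c.HasDegree d k) (h' : c.HasDegree d' k') :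
    c.HasDegree (d * d') (k + k') := by
  have := c.pathConnected
  let δ' := PathConnectedSpace.somePath c.base ((d' : X ≃ₜ X) c.base)
  let δ := PathConnectedSpace.somePath ((d' : X ≃ₜ X) c.base)
    ((d : X ≃ₜ X) ((d' : X ≃ₜ X) c.base))
  obtain ⟨a, ha⟩ := h.dvd δ rfl
  obtain ⟨b, hb⟩ := h'.dvd δ' rfl
  refine ⟨c.base, _, δ'.trans δ, rfl, a + b, ?_⟩
  rw [PathCocycle.trans]
  linear_combination ha + hb

theorem hasDegree_one : c.HasDegree 1 0 :=
  ⟨c.base, _, Path.refl _, rfl, by rw [PathCocycle.val_refl]; simp⟩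

theorem exists_hasDegree (d : c.Deck) : ∃ k, c.HasDegree d k := by
  have := c.pathConnected
  let δ := PathConnectedSpace.somePath c.base ((d : X ≃ₜ X) c.base)
  exact ⟨c.degree.val δ, c.base, _, δ, rfl, by simp⟩

theorem HasDegree.inv {d : c.Deck} {k : ℤ} (h : c.HasDegree d k) : c.HasDegree d⁻¹ (-k) := by
  obtain ⟨l, hl⟩ := exists_hasDegree d⁻¹
  obtain ⟨a, ha⟩ := (h.mul hl).dvd (Path.refl c.base) (by rw [mul_inv_cancel]; rfl)
  rw [PathCocycle.val_refl] at ha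
  exact hl.congr ⟨-a, by linear_combination -ha⟩

theorem HasDegree.zpow {d : c.Deck} {k : ℤ} (h : c.HasDegree d k) (n : ℤ) :
    c.HasDegree (d ^ n) (n * k) := by
  induction n using Int.induction_on with
  | zero => simpa using hasDegree_one
  | succ n ih =>
    rw [zpow_add_one, add_mul, one_mul]
    exact ih.mul h
  | pred n ih =>
    rw [zpow_sub_one, sub_mul, one_mul, sub_eq_add_neg]
    exact ih.mul h.inv

variable (c)

theorem exists_deck_apply_eq [LocallyPathConnectedSpace S] {x y : X} (h : c.proj y = c.proj x) :
    ∃ d : c.Deck, (d : X ≃ₜ X) x = y := by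
  obtain ⟨F, hF, hF'⟩ := c.exists_homeomorph_lift m.preservesCrossing_one h
  exact ⟨⟨F, hF'⟩, hF⟩

theorem exists_path_crossGen [LocallyPathConnectedSpace S] (k : ℤ) :
    ∃ (d : c.Deck) (δ : Path c.base ((d : X ≃ₜ X) c.base)),
      m.elt (c.down δ c.proj_base ((d.2 _).trans c.proj_base)) = crossGen r ^ k ∧
      c.HasDegree d k := by
  obtain ⟨γ, hγ⟩ := m.exists_elt_eq (crossGen r ^ k)
  obtain ⟨y, hy, δ, hδ⟩ := c.exists_lift_path (γ.cast c.proj_base rfl)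
  obtain ⟨d, rfl⟩ := c.exists_deck_apply_eq (hy.trans c.proj_base.symm)
  have e : m.elt (c.down δ c.proj_base hy) = crossGen r ^ k := by
    rw [← hγ]
    exact congrArg m.elt (Path.ext (funext hδ))
  refine ⟨d, δ, e, c.base, _, δ, rfl, ?_⟩
  rw [c.degree_eq_crossingNumber δ c.proj_base hy, e, crossingNumber_zpow, crossingNumber_crossGen]
  simp

/-- The deck transformation of degree one. -/
def deckGen [LocallyPathConnectedSpace S] : c.Deck := (c.exists_path_crossGen 1).choose

theorem hasDegree_deckGen [LocallyPathConnectedSpace S] : c.HasDegree c.deckGen 1 :=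
  (c.exists_path_crossGen 1).choose_spec.choose_spec.2

variable {c}

theorem HasDegree.eq_zpow [LocallyPathConnectedSpace S] {d : c.Deck} {k : ℤ}
    (h : c.HasDegree d k) : d = c.deckGen ^ k :=
  h.eq (by simpa using c.hasDegree_deckGen.zpow k)

theorem deckGen_zpow_eq_one [LocallyPathConnectedSpace S] {k : ℤ} (hk : (q : ℤ) ∣ k) :
    c.deckGen ^ k = 1 :=
  (HasDegree.eq_zpow (hasDegree_one.congr (by simpa using hk))).symm

/-- The conjugate of `d` by `F` is a deck transformation. It has the degree of `d` because `f`
preserves intersection numbers, and the degree modulo `q` determines a deck transformation. -/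
theorem lift_deck_comm {f : S ≃ₜ S} (hf : m.PreservesCrossing f) {F : X ≃ₜ X}
    (hF : ∀ x, c.proj (F x) = f (c.proj x)) (d : c.Deck) :
    F * (d : X ≃ₜ X) = (d : X ≃ₜ X) * F := by
  have hd' : F * (d : X ≃ₜ X) * F⁻¹ ∈ c.Deck := fun x => by
    rw [Homeomorph.mul_apply, Homeomorph.mul_apply, hF, d.2, ← hF]
    exact congrArg c.proj (F.apply_symm_apply x)
  obtain ⟨k, hk⟩ := exists_hasDegree d
  have := c.pathConnected
  let δ := PathConnectedSpace.somePath c.base ((d : X ≃ₜ X) c.base)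
  have e : c.HasDegree ⟨_, hd'⟩ k := by
    refine ⟨F c.base, _, δ.map F.continuous,
      congrArg (fun x => F ((d : X ≃ₜ X) x)) (F.symm_apply_apply _), ?_⟩
    have e' : c.degree.val (δ.map F.continuous) = c.degree.val δ :=
      Eq.trans (m.crossing.val_congr
        (γ' := (δ.map c.proj.continuous).map f.continuous) fun t => hF (δ t))
        (hf.map_path (d.2 c.base).symm (δ.map c.proj.continuous))
    rw [e']
    exact hk.dvd δ rfl
  have h := congrArg Subtype.val (e.eq hk)
  exact (mul_inv_eq_iff_eq_mul).1 h

end Degree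

end CyclicCover

/-! ### The homology of a cyclic cover -/

theorem monoidAlgebra_int_induction {G : Type*} [Monoid G] {p : MonoidAlgebra ℤ G → Prop}
    (of : ∀ g, p (MonoidAlgebra.of ℤ G g)) (zero : p 0) (add : ∀ x y, p x → p y → p (x + y))
    (neg : ∀ x, p x → p (-x)) (x : MonoidAlgebra ℤ G) : p x := by
  have smul (n : ℤ) (g : G) : p (n • MonoidAlgebra.of ℤ G g) := by
    induction n using Int.induction_on with
    | zero => simpa using zero
    | succ n ih => rw [add_smul, one_smul]; exact add _ _ ih (of g)
    | pred n ih =>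
      rw [sub_smul, one_smul, sub_eq_add_neg]
      exact add _ _ ih (neg _ (of g))
  induction x using MonoidAlgebra.induction_linear with
  | zero => exact zero
  | add x y hx hy => exact add x y hx hy
  | single g n => simpa [MonoidAlgebra.of_apply] using smul n g

namespace CyclicCover

variable {r : ℕ} {S : Type} [TopologicalSpace S]
  {m : StandardSystem (r + 1) S} {q : ℕ} {X : Type} [TopologicalSpace X] (c : CyclicCover m q X)

theorem deckAction_of (d : c.Deck) :
    c.deckAction (MonoidAlgebra.of ℤ c.Deck d) = H1map (homeoMap (d : X ≃ₜ X)) :=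
  MonoidAlgebra.lift_of _ _

theorem deckAction_mul_apply (x y : c.DeckRing) (h : H1 X) :
    c.deckAction (x * y) h = c.deckAction x (c.deckAction y h) := by
  rw [map_mul]; rfl

/-- The lifts of the loops `α i`, `β i` for `i < g`. -/
def liftLoop (j : Fin r ⊕ Fin r) : Path c.base c.base := Sum.elim c.liftα c.liftβ j

theorem basisClass_eq (j : Fin r ⊕ Fin r) : c.basisClass j = loopClass (c.liftLoop j) := by
  rcases j with i | i <;> rfl

theorem proj_liftLoop (j : Fin r ⊕ Fin r) (t : I) : c.proj (c.liftLoop j t) = m.sideLoop j t := by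
  rcases j with i | i
  · exact c.proj_liftα i t
  · exact c.proj_liftβ i t

theorem elt_down_liftLoop (j : Fin r ⊕ Fin r) :
    m.elt (c.down (c.liftLoop j) c.proj_base c.proj_base) = sideGen j := by
  rw [← m.elt_sideLoop]
  exact congrArg m.elt (Path.ext (funext (c.proj_liftLoop j)))

theorem loopClass_eq_of_elt_down_eq {γ γ' : Path c.base c.base}
    (h : m.elt (c.down γ c.proj_base c.proj_base) = m.elt (c.down γ' c.proj_base c.proj_base)) :
    loopClass γ = loopClass γ' :=
  loopClass_eq_of_homotopic (c.homotopic_of_elt_down_eq h)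

theorem elt_down_conj {x y : X} (δ : Path x y) (γ : Path y y) (hx : c.proj x = m.base)
    (hy : c.proj y = m.base) :
    m.elt (c.down (δ.trans (γ.trans δ.symm)) hx hx) =
      (m.elt (c.down δ hx hy))⁻¹ * m.elt (c.down γ hy hy) * m.elt (c.down δ hx hy) := by
  rw [c.elt_down_trans _ _ hx hy hx, c.elt_down_trans _ _ hy hy hx, c.elt_down_symm]

theorem elt_down_refl : m.elt (c.down (Path.refl c.base) c.proj_base c.proj_base) = 1 := by
  rw [← m.elt_refl]
  exact congrArg m.elt (Path.ext (funext fun _ => c.proj_base))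

/-- The elements of the surface group that lift to null-homologous loops. -/
def nullSubgroup : Subgroup (SurfaceGroup (r + 1)) where
  carrier := {x | ∃ γ : Path c.base c.base,
    m.elt (c.down γ c.proj_base c.proj_base) = x ∧ loopClass γ = 0}
  one_mem' := ⟨Path.refl _, c.elt_down_refl, loopClass_refl _⟩
  mul_mem' := by
    rintro _ _ ⟨γ, rfl, hγ⟩ ⟨γ', rfl, hγ'⟩
    exact ⟨γ'.trans γ, c.elt_down_trans _ _ _ _ _, by rw [loopClass_trans, hγ, hγ', add_zero]⟩
  inv_mem' := by
    rintro _ ⟨γ, rfl, hγ⟩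
    exact ⟨γ.symm, c.elt_down_symm _ _ _, by rw [loopClass_symm, hγ, neg_zero]⟩

theorem mem_nullSubgroup_iff (γ : Path c.base c.base) :
    m.elt (c.down γ c.proj_base c.proj_base) ∈ c.nullSubgroup ↔ loopClass γ = 0 := by
  refine ⟨?_, fun h => ⟨γ, rfl, h⟩⟩
  rintro ⟨γ', h, h'⟩
  rw [← c.loopClass_eq_of_elt_down_eq h, h']

theorem commutator_mem_nullSubgroup (γ γ' : Path c.base c.base) :
    m.elt (c.down γ c.proj_base c.proj_base) * m.elt (c.down γ' c.proj_base c.proj_base) *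
      (m.elt (c.down γ c.proj_base c.proj_base))⁻¹ *
      (m.elt (c.down γ' c.proj_base c.proj_base))⁻¹ ∈ c.nullSubgroup := by
  refine ⟨γ'.symm.trans (γ.symm.trans (γ'.trans γ)), ?_, ?_⟩
  · rw [c.elt_down_trans _ _ _ c.proj_base, c.elt_down_trans _ _ _ c.proj_base,
      c.elt_down_trans _ _ _ c.proj_base, c.elt_down_symm, c.elt_down_symm]
  · simp only [loopClass_trans, loopClass_symm]
    abel

/-- A lift of the loop `α_g`. -/
def coreLoop : Path c.base c.base :=
  (c.exists_down_homotopic (coreGen r) (by rw [crossingNumber_coreGen]; exact dvd_zero _)).choose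

theorem elt_down_coreLoop : m.elt (c.down c.coreLoop c.proj_base c.proj_base) = coreGen r :=
  (c.exists_down_homotopic (coreGen r) (by rw [crossingNumber_coreGen]; exact dvd_zero _)).choose_spec

theorem dvd_crossingNumber_crossGen_pow (r q : ℕ) :
    (q : ℤ) ∣ crossingNumber (crossGen r ^ q) := by
  rw [← zpow_natCast, crossingNumber_zpow, crossingNumber_crossGen, mul_one]

/-- A lift of the `q`-th power of the loop `β_g`. -/
def crossLoop : Path c.base c.base :=
  (c.exists_down_homotopic (crossGen r ^ q) (dvd_crossingNumber_crossGen_pow r q)).choose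

theorem elt_down_crossLoop :
    m.elt (c.down c.crossLoop c.proj_base c.proj_base) = crossGen r ^ q :=
  (c.exists_down_homotopic (crossGen r ^ q) (dvd_crossingNumber_crossGen_pow r q)).choose_spec

variable [PathConnectedSpace S] [LocallyPathConnectedSpace S]

/-- The unit of the group ring given by the deck transformation of degree one. -/
def deckUnit : c.DeckRingˣ :=
  Units.map (MonoidAlgebra.of ℤ c.Deck) (toUnits c.deckGen)

theorem deckUnit_zpow (k : ℤ) :
    ((c.deckUnit ^ k : c.DeckRingˣ) : c.DeckRing) = MonoidAlgebra.of ℤ c.Deck (c.deckGen ^ k) := by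
  rw [deckUnit, ← map_zpow, ← map_zpow]
  rfl

theorem deckUnit_zpow_eq_one {k : ℤ} (hk : (q : ℤ) ∣ k) : c.deckUnit ^ k = 1 := by
  ext1
  rw [deckUnit_zpow, deckGen_zpow_eq_one hk, map_one, Units.val_one]

/-- The vector of Fox derivatives as a homomorphism on the fundamental group of the cover. -/
def foxHom : FundamentalGroup X c.base →* Multiplicative (Fin r ⊕ Fin r → c.DeckRing) where
  toFun a := Multiplicative.ofAdd (fox c.deckUnit
    (m.iso.symm (FundamentalGroup.mapOfEq c.proj c.proj_base a)))
  map_one' := by rw [map_one, map_one, fox_one]; rfl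
  map_mul' a b := by
    -- Loops of the cover have intersection number divisible by `q`, so the twist is trivial and the
    -- crossed homomorphism becomes a homomorphism.
    have h := (c.mem_range_iff _).1 ⟨a, rfl⟩
    rw [map_mul, map_mul, fox_mul, c.deckUnit_zpow_eq_one, one_smul, ofAdd_add]
    exact (dvd_neg).2 h

/-- The coordinates of homology classes of the cover with respect to the lifted curves. -/
def coord : H1 X →+ (Fin r ⊕ Fin r → c.DeckRing) :=
  haveI := c.pathConnected
  H1lift c.base c.foxHom

theorem coord_loopClass_base (γ : Path c.base c.base) :
    c.coord (loopClass γ) = fox c.deckUnit (m.elt (c.down γ c.proj_base c.proj_base)) := by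
  have := c.pathConnected
  rw [coord, H1lift_loopClass]
  change fox c.deckUnit
    (m.iso.symm (FundamentalGroup.mapOfEq c.proj c.proj_base (loopElt γ))) = _
  rw [FundamentalGroup.mapOfEq_apply]
  rfl

theorem coord_loopClass {x : X} (δ : Path c.base x) (γ : Path x x) (hx : c.proj x = m.base) :
    c.coord (loopClass γ) =
      c.deckUnit ^ c.degree.val δ • fox c.deckUnit (m.elt (c.down γ hx hx)) := by
  rw [← loopClass_conj δ γ, coord_loopClass_base, c.elt_down_conj δ γ c.proj_base hx, fox_conj,
    ← c.degree_eq_crossingNumber]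
  rw [← c.degree_eq_crossingNumber]
  exact c.deckUnit_zpow_eq_one (c.dvd_degree_loop γ)

theorem coord_deck_basisClass (d : c.Deck) (j : Fin r ⊕ Fin r) :
    c.coord (H1map (homeoMap (d : X ≃ₜ X)) (c.basisClass j)) =
      Pi.single j (MonoidAlgebra.of ℤ c.Deck d) := by
  have := c.pathConnected
  let δ := PathConnectedSpace.somePath c.base ((d : X ≃ₜ X) c.base)
  have hx : c.proj ((d : X ≃ₜ X) c.base) = m.base := (d.2 _).trans c.proj_base
  have hd : c.HasDegree d (c.degree.val δ) := ⟨c.base, _, δ, rfl, by simp⟩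
  have e : m.elt (c.down ((c.liftLoop j).map (d : X ≃ₜ X).continuous) hx hx) = sideGen j := by
    rw [← c.elt_down_liftLoop]
    exact congrArg m.elt (Path.ext (funext fun t => d.2 _))
  rw [basisClass_eq, H1map_loopClass]
  refine (c.coord_loopClass δ _ hx).trans ?_
  rw [e, fox_sideGen]
  conv_rhs => rw [hd.eq_zpow, ← c.deckUnit_zpow]
  funext i
  by_cases h : i = j
  · subst h
    simp [Units.smul_def]
  · simp [h]

theorem coord_deckAction_basisClass (x : c.DeckRing) (j : Fin r ⊕ Fin r) :
    c.coord (c.deckAction x (c.basisClass j)) = Pi.single j x := by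
  refine monoidAlgebra_int_induction (p := fun x =>
    c.coord (c.deckAction x (c.basisClass j)) = Pi.single j x) ?_ ?_ ?_ ?_ x
  · intro d
    rw [deckAction_of]
    exact c.coord_deck_basisClass d j
  · simp
  · intro x y hx hy
    rw [map_add, LinearMap.add_apply, map_add, hx, hy, Pi.single_add]
  · intro x hx
    rw [map_neg, LinearMap.neg_apply, map_neg, hx, Pi.single_neg]

theorem coord_sum (v : Fin r ⊕ Fin r → c.DeckRing) :
    c.coord (∑ i, c.deckAction (v i) (c.basisClass i)) = v := by
  simp only [map_sum, coord_deckAction_basisClass]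
  exact Finset.univ_sum_single v

theorem IsActionMatrix.apply {c : CyclicCover m q X} {F : X ≃ₜ X}
    {M : Matrix (Fin r ⊕ Fin r) (Fin r ⊕ Fin r) c.DeckRing} (h : c.IsActionMatrix F M)
    (i j : Fin r ⊕ Fin r) : M i j = c.coord (H1map (homeoMap F) (c.basisClass j)) i := by
  rw [h j, coord_sum c fun i => M i j]

theorem IsActionMatrix.unique {c : CyclicCover m q X} {F : X ≃ₜ X}
    {M M' : Matrix (Fin r ⊕ Fin r) (Fin r ⊕ Fin r) c.DeckRing} (h : c.IsActionMatrix F M)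
    (h' : c.IsActionMatrix F M') : M = M' := by
  ext1 i j
  rw [h.apply, h'.apply]

/-! ### Generators of the homology of a cyclic cover -/

/-- Conjugation by `b_g ^ k` downstairs is a deck translation upstairs, joined to the base point by
a lift of `b_g ^ (-k)`; the sign comes from the reversed product. -/
theorem exists_loop_conj (k : ℤ) (γ : Path c.base c.base) : ∃ γ' : Path c.base c.base,
    m.elt (c.down γ' c.proj_base c.proj_base) =
      crossGen r ^ k * m.elt (c.down γ c.proj_base c.proj_base) * (crossGen r ^ k)⁻¹ ∧
    loopClass γ' = H1map (homeoMap ((c.deckGen ^ (-k) : c.Deck) : X ≃ₜ X)) (loopClass γ) := by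
  obtain ⟨d, δ, hδ, hd⟩ := c.exists_path_crossGen (-k)
  have hx : c.proj ((d : X ≃ₜ X) c.base) = m.base := (d.2 _).trans c.proj_base
  refine ⟨δ.trans ((γ.map (d : X ≃ₜ X).continuous).trans δ.symm), ?_, ?_⟩
  · rw [c.elt_down_conj δ _ c.proj_base hx, hδ, zpow_neg, inv_inv]
    congr 2
    exact congrArg m.elt (Path.ext (funext fun t => d.2 _))
  · rw [loopClass_conj, ← hd.eq_zpow, H1map_loopClass]

/-- Deck translation is conjugation by a power of `b_g`, which commutes with `b_g ^ q`. -/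
theorem deck_loopClass_crossLoop (d : c.Deck) :
    H1map (homeoMap (d : X ≃ₜ X)) (loopClass c.crossLoop) = loopClass c.crossLoop := by
  obtain ⟨k, hk⟩ := exists_hasDegree d
  obtain ⟨γ, h, h'⟩ := c.exists_loop_conj (-k) c.crossLoop
  rw [neg_neg, ← hk.eq_zpow] at h'
  rw [← h']
  refine c.loopClass_eq_of_elt_down_eq (h.trans ?_)
  rw [elt_down_crossLoop]
  group

theorem deck_loopClass_coreLoop (d : c.Deck) :
    H1map (homeoMap (d : X ≃ₜ X)) (loopClass c.coreLoop) = loopClass c.coreLoop := by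
  -- By the surface relation, `[a_g, b_g]` is the inverse of a product of commutators of loops that
  -- lift to closed loops, so its lift is null-homologous. This says that the class of the lift of
  -- `α_g` equals its translate by a generator of the deck group.
  have hrel : coreGen r * crossGen r * (coreGen r)⁻¹ * (crossGen r)⁻¹ ∈ c.nullSubgroup := by
    have h := surfaceGroup_relation r
    rw [mul_eq_one_iff_inv_eq] at h
    refine h ▸ c.nullSubgroup.inv_mem (Subgroup.list_prod_mem _ fun x hx => ?_)
    obtain ⟨i, rfl⟩ := (List.mem_ofFn' _ _).1 hx
    have := c.commutator_mem_nullSubgroup (c.liftLoop (Sum.inl i)) (c.liftLoop (Sum.inr i))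
    rw [elt_down_liftLoop, elt_down_liftLoop] at this
    exact this
  obtain ⟨γ, h, h'⟩ := c.exists_loop_conj 1 c.coreLoop.symm
  rw [c.elt_down_symm, elt_down_coreLoop, zpow_one] at h
  have h0 := (c.mem_nullSubgroup_iff (γ.trans c.coreLoop)).1 (by
    rw [c.elt_down_trans _ _ _ c.proj_base, h, elt_down_coreLoop]
    simpa [mul_assoc] using hrel)
  rw [loopClass_trans, h', loopClass_symm, map_neg, neg_add_eq_zero] at h0
  let H : Subgroup c.Deck :=
    { carrier := {d | H1map (homeoMap (d : X ≃ₜ X)) (loopClass c.coreLoop) = loopClass c.coreLoop}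
      one_mem' := by
        change c.deckHom 1 _ = _
        rw [map_one]; rfl
      mul_mem' := by
        intro d e hd he
        change c.deckHom (d * e) _ = _
        change c.deckHom d _ = _ at hd
        change c.deckHom e _ = _ at he
        rw [map_mul, Module.End.mul_apply, he, hd]
      inv_mem' := by
        intro d hd
        change c.deckHom d⁻¹ _ = _
        change c.deckHom d _ = _ at hd
        nth_rw 1 [← hd]
        rw [← Module.End.mul_apply, ← map_mul, inv_mul_cancel, map_one]; rfl }
  obtain ⟨k, hk⟩ := exists_hasDegree d
  have h1 : c.deckGen ^ (-1 : ℤ) ∈ H := h0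
  have h2 : c.deckGen ∈ H := by simpa using H.inv_mem h1
  have h3 := H.zpow_mem h2 k
  rw [← hk.eq_zpow] at h3
  exact h3

/-- The homology classes that are combinations of the lifted curves, of the lift of `α_g` and of
the lift of the `q`-th power of `β_g`. -/
def spanGroup : AddSubgroup (H1 X) where
  carrier := {h | ∃ (v : Fin r ⊕ Fin r → c.DeckRing) (k l : ℤ),
    h = ∑ i, c.deckAction (v i) (c.basisClass i) + k • loopClass c.coreLoop +
      l • loopClass c.crossLoop}
  zero_mem' := ⟨0, 0, 0, by simp⟩
  add_mem' := by
    rintro _ _ ⟨v, k, l, rfl⟩ ⟨v', k', l', rfl⟩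
    refine ⟨v + v', k + k', l + l', ?_⟩
    simp only [Pi.add_apply, map_add, LinearMap.add_apply, Finset.sum_add_distrib, add_zsmul]
    abel
  neg_mem' := by
    rintro _ ⟨v, k, l, rfl⟩
    refine ⟨-v, -k, -l, ?_⟩
    simp only [Pi.neg_apply, map_neg, LinearMap.neg_apply, Finset.sum_neg_distrib, neg_zsmul]
    abel

theorem deck_mem_spanGroup (d : c.Deck) {h : H1 X} (hh : h ∈ c.spanGroup) :
    H1map (homeoMap (d : X ≃ₜ X)) h ∈ c.spanGroup := by
  obtain ⟨v, k, l, rfl⟩ := hh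
  refine ⟨fun i => MonoidAlgebra.of ℤ c.Deck d * v i, k, l, ?_⟩
  simp only [map_add, map_sum, map_zsmul, deck_loopClass_crossLoop, deck_loopClass_coreLoop,
    deckAction_mul_apply, deckAction_of]

theorem mem_spanGroup (h : H1 X) : h ∈ c.spanGroup := by
  have := c.pathConnected
  obtain ⟨γ, rfl⟩ := loopClass_surjective c.base h
  let H : Subgroup (SurfaceGroup (r + 1)) :=
    { carrier := {x | ∃ γ : Path c.base c.base,
        m.elt (c.down γ c.proj_base c.proj_base) = x ∧ loopClass γ ∈ c.spanGroup}
      one_mem' := ⟨Path.refl _, c.elt_down_refl, by rw [loopClass_refl]; exact c.spanGroup.zero_mem⟩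
      mul_mem' := by
        rintro _ _ ⟨γ, rfl, hγ⟩ ⟨γ', rfl, hγ'⟩
        exact ⟨γ'.trans γ, c.elt_down_trans _ _ _ _ _, by
          rw [loopClass_trans]; exact c.spanGroup.add_mem hγ' hγ⟩
      inv_mem' := by
        rintro _ ⟨γ, rfl, hγ⟩
        exact ⟨γ.symm, c.elt_down_symm _ _ _, by
          rw [loopClass_symm]; exact c.spanGroup.neg_mem hγ⟩ }
  have key : m.elt (c.down γ c.proj_base c.proj_base) ∈ H := by
    -- Downstairs, the fundamental group of the cover is generated by the conjugates, under powers
    -- of `b_g`, of the side generators, of `a_g` and of `b_g ^ q`.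
    refine mem_of_dvd_crossingNumber (q := q) H (fun j => ?_) ?_ ?_ ?_
      (c.dvd_crossingNumber_down γ)
    · refine ⟨c.liftLoop j, c.elt_down_liftLoop j, Pi.single j 1, 0, 0, ?_⟩
      rw [Finset.sum_eq_single j]
      · simp [basisClass_eq]
      · intro i _ hi
        simp [hi]
      · simp
    · exact ⟨c.coreLoop, c.elt_down_coreLoop, 0, 1, 0, by simp⟩
    · exact ⟨c.crossLoop, c.elt_down_crossLoop, 0, 0, 1, by simp⟩
    · rintro k _ ⟨γ, rfl, hγ⟩
      obtain ⟨γ', h, h'⟩ := c.exists_loop_conj k γ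
      exact ⟨γ', h, by rw [h']; exact c.deck_mem_spanGroup _ hγ⟩
  obtain ⟨γ', h, h'⟩ := key
  rwa [← c.loopClass_eq_of_elt_down_eq h]

end CyclicCover

/-! ### Homotopic homeomorphisms -/

theorem exists_homotopy_of_isotopic {S : Type} [TopologicalSpace S] {f f' : S ≃ₜ S}
    (h : (f : MappingClassGroup S) = f') :
    Nonempty (ContinuousMap.Homotopy (homeoMap f) (homeoMap f')) := by
  obtain ⟨Φ, -, h0, h1⟩ := QuotientGroup.eq.1 h
  refine ⟨⟨⟨fun z => f (Φ z).2, by fun_prop⟩, fun x => congrArg f (h0 x), fun x => ?_⟩⟩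
  exact (congrArg f (h1 x)).trans (f.apply_symm_apply _)

/-- A free homotopy of a loop conjugates it by the trace of its base point, and this trace cancels
in the chains. -/
theorem H1map_eq_of_homotopy {X Y : Type} [TopologicalSpace X] [TopologicalSpace Y]
    [PathConnectedSpace X] {f f' : C(X, Y)} (H : ContinuousMap.Homotopy f f') :
    H1map f = H1map f' := by
  ext h
  obtain ⟨γ, rfl⟩ := loopClass_surjective (Classical.arbitrary X) h
  rw [H1map_loopClass, H1map_loopClass, loopClass_eq_iff]
  have e := pathChain_eq_of_homotopic (Path.Homotopic.map_trans_evalAt H γ)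
  rw [pathChain_trans, pathChain_trans, add_comm] at e
  exact add_left_cancel e

theorem H1map_eq_id_of_mem_torelli {S : Type} [TopologicalSpace S] [PathConnectedSpace S]
    {f : S ≃ₜ S} (hf : (f : MappingClassGroup S) ∈ Torelli S) :
    H1map (homeoMap f) = LinearMap.id := by
  obtain ⟨f', h, h'⟩ := hf
  obtain ⟨H⟩ := exists_homotopy_of_isotopic h.symm
  rw [H1map_eq_of_homotopy H, h']

theorem loopClass_cast {X : Type} [TopologicalSpace X] {x y : X} (γ : Path x x) (h : y = x) :
    loopClass (γ.cast h h) = loopClass γ := by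
  subst h; rfl

namespace StandardSystem

variable {r : ℕ} {S : Type} [TopologicalSpace S] (m : StandardSystem (r + 1) S)

/-- The action of a homeomorphism on the surface group that is defined by a path from the base
point to its image. -/
def twist (f : S ≃ₜ S) (β : Path m.base (f m.base)) (γ : Path m.base m.base) :
    SurfaceGroup (r + 1) :=
  m.elt (β.trans ((γ.map f.continuous).trans β.symm))

/-- The two actions differ by conjugation by the loop made of `β`, the trace of the base point and
`β'` reversed. The double inverse gives the right-hand side the shape `x⁻¹ * z * x` of `fox_conj`.
-/
theorem twist_eq_of_homotopy {f f' : S ≃ₜ S}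
    (H : ContinuousMap.Homotopy (homeoMap f) (homeoMap f')) (β : Path m.base (f m.base))
    (β' : Path m.base (f' m.base)) (γ : Path m.base m.base) :
    m.twist f' β' γ = (m.elt ((β.trans (H.evalAt m.base)).trans β'.symm))⁻¹⁻¹ * m.twist f β γ *
      (m.elt ((β.trans (H.evalAt m.base)).trans β'.symm))⁻¹ := by
  have e := Path.Homotopic.map_trans_evalAt H γ
  rw [twist, twist, ← m.elt_symm, ← m.elt_conj, m.elt_eq_iff]
  rw [← pathHom_eq_iff] at e ⊢
  simp only [pathHom_trans, pathHom_symm, IsIso.inv_comp, IsIso.inv_inv, Category.assoc] at e ⊢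
  change pathHom (γ.map f.continuous) ≫ _ = _ ≫ pathHom (γ.map f'.continuous) at e
  have e' := congrArg (fun a => inv (pathHom (H.evalAt m.base)) ≫ a) e
  simp only [IsIso.inv_hom_id_assoc] at e'
  erw [← e']
  simp

/-- The matrix of Fox derivatives of the images of the loops `α i`, `β i` for `i < g`. -/
def foxMatrix {R : Type} [Ring R] (u : Rˣ) (f : S ≃ₜ S) (β : Path m.base (f m.base)) :
    Matrix (Fin r ⊕ Fin r) (Fin r ⊕ Fin r) R :=
  Matrix.of fun i j => fox u (m.twist f β (m.sideLoop j)) i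

variable [PathConnectedSpace S]

variable {m} in
theorem PreservesCrossing.crossingNumber_twist {f : S ≃ₜ S} (hf : m.PreservesCrossing f)
    (β : Path m.base (f m.base)) (γ : Path m.base m.base) :
    crossingNumber (m.twist f β γ) = crossingNumber (m.elt γ) := by
  rw [twist, ← m.crossing_loop, ← m.crossing_loop,
    m.crossing.val_eq_of_loopClass_eq (loopClass_conj _ _), hf]

/-- The exponent is the intersection number of the conjugating loop, so one `k` serves all columns,
all rings and all units. `fox_conj` applies because the images of the side loops still have
intersection number zero. -/
theorem exists_fox_twist_eq {f f' : S ≃ₜ S} (hf : m.PreservesCrossing f)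
    (h : (f : MappingClassGroup S) = f') (β : Path m.base (f m.base))
    (β' : Path m.base (f' m.base)) : ∃ k : ℤ, ∀ {R : Type} [Ring R] (u : Rˣ) (j : Fin r ⊕ Fin r),
      fox u (m.twist f' β' (m.sideLoop j)) = u ^ k • fox u (m.twist f β (m.sideLoop j)) := by
  obtain ⟨H⟩ := exists_homotopy_of_isotopic h
  refine ⟨crossingNumber (m.elt ((β.trans (H.evalAt m.base)).trans β'.symm))⁻¹, fun u j => ?_⟩
  rw [m.twist_eq_of_homotopy H β β', fox_conj]
  rw [hf.crossingNumber_twist, m.elt_sideLoop, crossingNumber_sideGen, zpow_zero]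

end StandardSystem

namespace CyclicCover

variable {r : ℕ} {S : Type} [TopologicalSpace S]
  {m : StandardSystem (r + 1) S} {q : ℕ} {X : Type} [TopologicalSpace X] (c : CyclicCover m q X)

theorem H1map_proj_loopClass {x : X} (γ : Path x x) (hx : c.proj x = m.base) :
    H1map c.proj (loopClass γ) = loopClass (c.down γ hx hx) := by
  rw [H1map_loopClass, down, loopClass_cast]

theorem H1map_proj_basisClass (j : Fin r ⊕ Fin r) :
    H1map c.proj (c.basisClass j) = loopClass (m.sideLoop j) := by
  rw [basisClass_eq, c.H1map_proj_loopClass _ c.proj_base]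
  exact congrArg loopClass (Path.ext (funext (c.proj_liftLoop j)))

theorem H1map_proj_deck (d : c.Deck) (h : H1 X) :
    H1map c.proj (H1map (homeoMap (d : X ≃ₜ X)) h) = H1map c.proj h := by
  rw [← LinearMap.comp_apply, ← H1map_comp]
  congr 2
  exact ContinuousMap.ext d.2

theorem H1map_proj_lift {F : X ≃ₜ X} {f : S ≃ₜ S} (hF : ∀ x, c.proj (F x) = f (c.proj x))
    (h : H1 X) : H1map c.proj (H1map (homeoMap F) h) = H1map (homeoMap f) (H1map c.proj h) := by
  rw [← LinearMap.comp_apply, ← LinearMap.comp_apply, ← H1map_comp, ← H1map_comp]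
  congr 2
  exact ContinuousMap.ext hF

/-! ### Existence of lifts and of action matrices, and their Fox description -/

theorem exists_lift_of_torelli [PathConnectedSpace S] [LocallyPathConnectedSpace S]
    (φ : Torelli S) : ∃ F, c.IsLift F φ := by
  obtain ⟨f, hf⟩ := QuotientGroup.mk_surjective (φ : MappingClassGroup S)
  have hp : m.PreservesCrossing f := m.preservesCrossing_of_H1map (H1map_eq_id_of_mem_torelli (hf ▸ φ.2))
  obtain ⟨y, hy, -⟩ := c.exists_lift_path
    (PathConnectedSpace.somePath (c.proj c.base) (f (c.proj c.base)))
  obtain ⟨F, -, hF⟩ := c.exists_homeomorph_lift hp hy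
  exact ⟨F, f, hf, hF⟩

theorem homologyHom_proj_deckAction [PathConnectedSpace S] {A : Type} [AddCommGroup A]
    (h : SurfaceGroup (r + 1) →* Multiplicative A) (hs : ∀ j, h (sideGen j) = 1) (x : c.DeckRing)
    (j : Fin r ⊕ Fin r) :
    m.homologyHom h (H1map c.proj (c.deckAction x (c.basisClass j))) = 0 := by
  refine monoidAlgebra_int_induction (p := fun x =>
    m.homologyHom h (H1map c.proj (c.deckAction x (c.basisClass j))) = 0) ?_ ?_ ?_ ?_ x
  · intro d
    rw [deckAction_of, H1map_proj_deck, H1map_proj_basisClass, m.homologyHom_loopClass,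
      m.elt_sideLoop, hs]
    rfl
  · simp
  · intro x y hx hy
    rw [map_add, LinearMap.add_apply, map_add, map_add, hx, hy, add_zero]
  · intro x hx
    rw [map_neg, LinearMap.neg_apply, map_neg, map_neg, hx, neg_zero]

/-- The homomorphism that is `1` on `a_g` and vanishes on the other generators. -/
def coreHom (r : ℕ) : SurfaceGroup (r + 1) →* Multiplicative ℤ :=
  surfaceLift (Pi.mulSingle (Sum.inl (Fin.last r)) (Multiplicative.ofAdd 1))
    fun _ => Commute.all _ _

theorem exists_isActionMatrix [PathConnectedSpace S] [LocallyPathConnectedSpace S] {F : X ≃ₜ X}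
    {f : S ≃ₜ S} (hf : H1map (homeoMap f) = LinearMap.id)
    (hF : ∀ x, c.proj (F x) = f (c.proj x)) : ∃ M, c.IsActionMatrix F M := by
  have key (j) : ∃ v : Fin r ⊕ Fin r → c.DeckRing, H1map (homeoMap F) (c.basisClass j) =
      ∑ i, c.deckAction (v i) (c.basisClass i) := by
    obtain ⟨v, k, l, h⟩ := c.mem_spanGroup (H1map (homeoMap F) (c.basisClass j))
    -- Project to `H₁(S)`, where `f` acts trivially, and apply a character that kills the side
    -- generators: only the two extra coefficients survive.
    have e (χ : SurfaceGroup (r + 1) →* Multiplicative ℤ) (hs : ∀ j, χ (sideGen j) = 1) :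
        k * (χ (coreGen r)).toAdd + l * (q * (χ (crossGen r)).toAdd) = 0 := by
      have e := congrArg (fun h => m.homologyHom χ (H1map c.proj h)) h
      simp only [map_add, map_sum, c.homologyHom_proj_deckAction χ hs, map_zsmul,
        c.H1map_proj_lift hF, hf, LinearMap.id_apply, c.H1map_proj_basisClass,
        c.H1map_proj_loopClass _ c.proj_base, m.homologyHom_loopClass, m.elt_sideLoop, hs,
        elt_down_coreLoop, elt_down_crossLoop, map_pow, toAdd_pow, toAdd_one,
        Finset.sum_const_zero, zero_add, smul_eq_mul, nsmul_eq_mul] at e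
      exact e.symm
    have hk : k = 0 := by
      have := e (coreHom r) fun j => by
        rw [coreHom, sideGen, surfaceLift_of]
        rcases j with i | i <;> simp [Fin.castSucc_ne_last]
      have h1 : coreHom r (coreGen r) = Multiplicative.ofAdd 1 := by
        rw [coreHom, coreGen, surfaceLift_of]; simp
      have h2 : coreHom r (crossGen r) = 1 := by
        rw [coreHom, crossGen, surfaceLift_of]; simp
      rw [h1, h2] at this
      simpa using this
    have hl : l • loopClass c.crossLoop = 0 := by
      have := e (intersectionWithA (Fin.last r)) fun j => crossingNumber_sideGen j
      change k * crossingNumber (coreGen r) + l * (q * crossingNumber (crossGen r)) = 0 at this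
      rw [crossingNumber_coreGen, crossingNumber_crossGen, mul_zero, zero_add, mul_one,
        mul_eq_zero] at this
      rcases this with rfl | hq
      · exact zero_zsmul _
      -- For `q = 0` nothing is known about `l`, but then `crossLoop` lifts `b_g ^ 0 = 1` and is
      -- null-homologous.
      · rw [(c.mem_nullSubgroup_iff c.crossLoop).1, zsmul_zero]
        have h1 : crossGen r ^ q = 1 := by rw [Nat.cast_eq_zero.1 hq, pow_zero]
        rw [elt_down_crossLoop, h1]
        exact c.nullSubgroup.one_mem
    exact ⟨v, by rw [h, hk, hl, zero_zsmul, add_zero, add_zero]⟩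
  choose v hv using key
  exact ⟨Matrix.of fun i j => v j i, hv⟩

/-- Joining the image of a lifted loop to the base point does not change its class, and the joined
loop projects to the twisted loop downstairs. The path `β` is the projection of a path from the base
point to its image. -/
theorem IsActionMatrix.eq_foxMatrix [PathConnectedSpace S] [LocallyPathConnectedSpace S]
    {c : CyclicCover m q X} {F : X ≃ₜ X} {M : Matrix (Fin r ⊕ Fin r) (Fin r ⊕ Fin r) c.DeckRing}
    (h : c.IsActionMatrix F M) {f : S ≃ₜ S} (hF : ∀ x, c.proj (F x) = f (c.proj x)) :
    ∃ β : Path m.base (f m.base), M = m.foxMatrix c.deckUnit f β := by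
  have := c.pathConnected
  let δ := PathConnectedSpace.somePath c.base (F c.base)
  have hb : f m.base = c.proj (F c.base) := by rw [hF, c.proj_base]
  refine ⟨(δ.map c.proj.continuous).cast c.proj_base.symm hb, ?_⟩
  ext1 i j
  rw [h.apply, basisClass_eq, H1map_loopClass]
  refine (congrArg (fun a => c.coord a i) (loopClass_conj δ _).symm).trans ?_
  rw [coord_loopClass_base]
  refine congrArg (fun a => fox c.deckUnit (m.elt a) i) ?_
  refine Path.ext (funext fun t => ?_)
  simp only [down, Path.map_trans, Path.cast_coe, Path.trans_apply, Path.map_coe,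
    Function.comp_apply, Path.symm_apply]
  split_ifs <;> first | rfl | (erw [hF, c.proj_liftLoop])

end CyclicCover

/-! ### Laurent polynomials -/

section Laurent

variable {R : Type} [Ring R]

/-- The evaluation of integral Laurent polynomials at a unit. -/
def laurentHom (u : Rˣ) : ℤ[T;T⁻¹] →ₐ[ℤ] R :=
  AddMonoidAlgebra.lift ℤ R ℤ ((Units.coeHom R).comp (zpowersHom Rˣ u))

theorem laurentHom_T (u : Rˣ) (k : ℤ) : laurentHom u (LaurentPolynomial.T k) = (u ^ k : Rˣ) := by
  refine (AddMonoidAlgebra.lift_of _ (Multiplicative.ofAdd k)).trans ?_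
  simp

/-- The indeterminate as a unit. -/
def laurentUnit : ℤ[T;T⁻¹]ˣ where
  val := LaurentPolynomial.T 1
  inv := LaurentPolynomial.T (-1)
  val_inv := by rw [← LaurentPolynomial.T_add]; simp
  inv_val := by rw [← LaurentPolynomial.T_add]; simp

theorem laurentUnit_zpow (k : ℤ) :
    ((laurentUnit ^ k : ℤ[T;T⁻¹]ˣ) : ℤ[T;T⁻¹]) = LaurentPolynomial.T k := by
  induction k using Int.induction_on with
  | zero => simp
  | succ n ih => rw [zpow_add_one, Units.val_mul, ih, LaurentPolynomial.T_add]; rfl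
  | pred n ih => rw [zpow_sub_one, Units.val_mul, ih, sub_eq_add_neg, LaurentPolynomial.T_add]; rfl

theorem map_laurentUnit (u : Rˣ) :
    Units.map (laurentHom u : ℤ[T;T⁻¹] →+* R).toMonoidHom laurentUnit = u := by
  ext
  exact (laurentHom_T u 1).trans (by rw [zpow_one])

theorem map_laurentHom {R' : Type} [Ring R'] (ψ : R →+* R') (u : Rˣ) (P : ℤ[T;T⁻¹]) :
    ψ (laurentHom u P) = laurentHom (Units.map ψ.toMonoidHom u) P := by
  have h : (ψ.toIntAlgHom).comp (laurentHom u) = laurentHom (Units.map ψ.toMonoidHom u) := by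
    refine AddMonoidAlgebra.algHom_ext (fun k => ?_) (Subsingleton.elim _ _)
    change ψ (laurentHom u (LaurentPolynomial.T k)) = laurentHom _ (LaurentPolynomial.T k)
    rw [laurentHom_T, laurentHom_T, ← map_zpow]
    rfl
  exact DFunLike.congr_fun h P

theorem laurentEval_eq_laurentHom (P : ℤ[T;T⁻¹]) (z : ℂˣ) :
    laurentEval P z = laurentHom z P := by
  rw [laurentHom, AddMonoidAlgebra.lift_apply, laurentEval]
  refine Finsupp.sum_congr fun k _ => ?_
  simp

/-! ### Laurent polynomials of bounded width -/

/-- The Laurent polynomials all of whose exponents lie in `[-n, n]`. -/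
def laurentWidth (n : ℕ) : AddSubgroup ℤ[T;T⁻¹] where
  carrier := {P | ∃ p : Polynomial ℤ, p.natDegree ≤ 2 * n ∧
    P = LaurentPolynomial.T (-n : ℤ) * p.toLaurent}
  zero_mem' := ⟨0, by simp, by simp⟩
  add_mem' := by
    rintro _ _ ⟨p, hp, rfl⟩ ⟨p', hp', rfl⟩
    exact ⟨p + p', Polynomial.natDegree_add_le_of_degree_le hp hp', by rw [map_add, mul_add]⟩
  neg_mem' := by
    rintro _ ⟨p, hp, rfl⟩
    exact ⟨-p, by rwa [Polynomial.natDegree_neg], by rw [map_neg, mul_neg]⟩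

theorem laurentWidth_mono {n n' : ℕ} (h : n ≤ n') : laurentWidth n ≤ laurentWidth n' := by
  rintro _ ⟨p, hp, rfl⟩
  refine ⟨Polynomial.X ^ (n' - n) * p, ?_, ?_⟩
  · refine Polynomial.natDegree_mul_le.trans ?_
    rw [Polynomial.natDegree_X_pow]
    omega
  · rw [map_mul, map_pow, Polynomial.toLaurent_X, LaurentPolynomial.T_pow, ← mul_assoc,
      ← LaurentPolynomial.T_add]
    congr 2
    push_cast [h]
    ring

theorem one_mem_laurentWidth (n : ℕ) : (1 : ℤ[T;T⁻¹]) ∈ laurentWidth n :=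
  laurentWidth_mono (Nat.zero_le n) ⟨1, by simp, by simp⟩

theorem mul_mem_laurentWidth {n n' : ℕ} {P P' : ℤ[T;T⁻¹]} (h : P ∈ laurentWidth n)
    (h' : P' ∈ laurentWidth n') : P * P' ∈ laurentWidth (n + n') := by
  obtain ⟨p, hp, rfl⟩ := h
  obtain ⟨p', hp', rfl⟩ := h'
  refine ⟨p * p', Polynomial.natDegree_mul_le.trans (by omega), ?_⟩
  rw [map_mul, mul_mul_mul_comm, ← LaurentPolynomial.T_add]
  congr 2
  push_cast
  ring

theorem exists_mem_laurentWidth (P : ℤ[T;T⁻¹]) : ∃ n, P ∈ laurentWidth n := by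
  obtain ⟨n, p, hp⟩ := P.exists_T_pow
  have h : P = LaurentPolynomial.T (-n : ℤ) * p.toLaurent := by
    rw [hp, mul_comm, mul_assoc, ← LaurentPolynomial.T_add]
    simp
  refine ⟨max n p.natDegree, Polynomial.X ^ (max n p.natDegree - n) * p, ?_, ?_⟩
  · refine Polynomial.natDegree_mul_le.trans ?_
    rw [Polynomial.natDegree_X_pow]
    omega
  · rw [map_mul, map_pow, Polynomial.toLaurent_X, LaurentPolynomial.T_pow, ← mul_assoc,
      ← LaurentPolynomial.T_add, h]
    congr 2
    push_cast [le_max_left n p.natDegree]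
    ring

theorem prod_mem_laurentWidth {ι : Type*} (s : Finset ι) (P : ι → ℤ[T;T⁻¹]) (n : ℕ)
    (h : ∀ i ∈ s, P i ∈ laurentWidth n) : ∏ i ∈ s, P i ∈ laurentWidth (s.card * n) := by
  classical
  induction s using Finset.induction_on with
  | empty => simpa using one_mem_laurentWidth 0
  | insert a s ha ih =>
    rw [Finset.prod_insert ha, Finset.card_insert_of_notMem ha, add_mul, one_mul, add_comm]
    exact mul_mem_laurentWidth (h _ (Finset.mem_insert_self _ _))
      (ih fun i hi => h i (Finset.mem_insert_of_mem hi))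

theorem det_mem_laurentWidth {r : ℕ} {N : Matrix (Fin r) (Fin r) ℤ[T;T⁻¹]} {n : ℕ}
    (h : ∀ i j, N i j ∈ laurentWidth n) : N.det ∈ laurentWidth (r * n) := by
  rw [Matrix.det_apply]
  refine AddSubgroup.sum_mem _ fun p _ => ?_
  rw [Units.smul_def]
  refine AddSubgroup.zsmul_mem _ ?_ _
  simpa using prod_mem_laurentWidth Finset.univ (fun i => N (p i) i) n fun i _ => h _ _

end Laurent

/-! ### The matrices of the lifts of a Torelli class -/

namespace StandardSystem

variable {r : ℕ} {S : Type} [TopologicalSpace S] (m : StandardSystem (r + 1) S)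

theorem foxMatrix_eq_map {R : Type} [Ring R] (u : Rˣ) (f : S ≃ₜ S) (β : Path m.base (f m.base)) :
    m.foxMatrix u f β = (m.foxMatrix laurentUnit f β).map (laurentHom u) := by
  ext1 i j
  have h := map_fox laurentUnit (laurentHom u : ℤ[T;T⁻¹] →+* R)
    (m.twist f β (m.sideLoop j)) i
  rw [map_laurentUnit] at h
  exact h.symm

end StandardSystem

namespace CyclicCover

variable {r : ℕ} {S : Type} [TopologicalSpace S]
  {m : StandardSystem (r + 1) S} {q : ℕ} {X : Type} [TopologicalSpace X] {c : CyclicCover m q X}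

theorem IsLift.mul {F F' : X ≃ₜ X} {φ φ' : MappingClassGroup S} (h : c.IsLift F φ)
    (h' : c.IsLift F' φ') : c.IsLift (F * F') (φ * φ') := by
  obtain ⟨f, rfl, hf⟩ := h
  obtain ⟨f', rfl, hf'⟩ := h'
  exact ⟨f * f', rfl, fun x => (hf _).trans (congrArg f (hf' x))⟩

/-- Some lift of `φ` acts by a matrix with exponents in `[-n, n]`. -/
def HasWidth (c : CyclicCover m q X) (τ : Multiplicative ℤ ≃* c.Deck) (φ : Torelli S) (n : ℕ) :
    Prop :=
  ∃ F, c.IsLift F φ ∧ ∀ i j, c.toLaurent τ (c.actionMatrix F i j) ∈ laurentWidth n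

theorem HasWidth.mono {τ : Multiplicative ℤ ≃* c.Deck} {φ : Torelli S} {n n' : ℕ}
    (h : c.HasWidth τ φ n) (hn : n ≤ n') : c.HasWidth τ φ n' := by
  obtain ⟨F, hF, hw⟩ := h
  exact ⟨F, hF, fun i j => laurentWidth_mono hn (hw i j)⟩

theorem lift_deckAction [PathConnectedSpace S] {F : X ≃ₜ X} {φ : Torelli S} (h : c.IsLift F φ) (x : c.DeckRing)
    (a : H1 X) : H1map (homeoMap F) (c.deckAction x a) = c.deckAction x (H1map (homeoMap F) a) := by
  obtain ⟨f, hf, hF⟩ := h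
  have hp : m.PreservesCrossing f :=
    m.preservesCrossing_of_H1map (H1map_eq_id_of_mem_torelli (hf ▸ φ.2))
  refine monoidAlgebra_int_induction (p := fun x =>
    H1map (homeoMap F) (c.deckAction x a) = c.deckAction x (H1map (homeoMap F) a)) ?_ ?_ ?_ ?_ x
  · intro d
    have e : (homeoMap F).comp (homeoMap (d : X ≃ₜ X)) =
        (homeoMap (d : X ≃ₜ X)).comp (homeoMap F) :=
      ContinuousMap.ext fun y => DFunLike.congr_fun (lift_deck_comm hp hF d) y
    rw [deckAction_of, ← LinearMap.comp_apply, ← H1map_comp, e, H1map_comp, LinearMap.comp_apply]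
  · simp
  · intro x y hx hy
    rw [map_add, LinearMap.add_apply, map_add, hx, hy, LinearMap.add_apply]
  · intro x hx
    rw [map_neg, LinearMap.neg_apply, map_neg, hx, LinearMap.neg_apply]

/-- Lifts of Torelli classes are linear over the group ring, since they commute with deck
transformations. The factors stand as `M' i j * M k i` because scalars act from the left, so
commutativity of the group ring is not needed. -/
theorem IsActionMatrix.mul [PathConnectedSpace S] {F F' : X ≃ₜ X} {φ : Torelli S} (h : c.IsLift F φ)
    {M M' : Matrix (Fin r ⊕ Fin r) (Fin r ⊕ Fin r) c.DeckRing} (hM : c.IsActionMatrix F M)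
    (hM' : c.IsActionMatrix F' M') :
    c.IsActionMatrix (F * F') (Matrix.of fun k j => ∑ i, M' i j * M k i) := by
  intro j
  have e : homeoMap (F * F') = (homeoMap F).comp (homeoMap F') := rfl
  rw [e, H1map_comp, LinearMap.comp_apply, hM' j]
  simp only [map_sum, lift_deckAction h, hM _, Matrix.of_apply, LinearMap.sum_apply,
    deckAction_mul_apply]
  exact Finset.sum_comm

variable [PathConnectedSpace S] [LocallyPathConnectedSpace S]

theorem IsLift.isActionMatrix {F : X ≃ₜ X} {φ : Torelli S} (h : c.IsLift F φ) :
    c.IsActionMatrix F (c.actionMatrix F) := by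
  obtain ⟨f, hf, hF⟩ := h
  exact Classical.epsilon_spec
    (c.exists_isActionMatrix (H1map_eq_id_of_mem_torelli (hf ▸ φ.2)) hF)

theorem IsLift.existsUnique_isActionMatrix {F : X ≃ₜ X} {φ : Torelli S} (h : c.IsLift F φ) :
    ∃! M, c.IsActionMatrix F M :=
  ⟨_, h.isActionMatrix, fun _ hM => hM.unique h.isActionMatrix⟩

/-- `N` is the Fox matrix of one representative and one path. The order of quantifiers matters: `N`
depends on `φ` alone and serves all covers, while only the exponent `k` depends on the lift. -/
theorem exists_laurentMatrix (m : StandardSystem (r + 1) S) (φ : Torelli S) :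
    ∃ N : Matrix (Fin r ⊕ Fin r) (Fin r ⊕ Fin r) ℤ[T;T⁻¹],
      ∀ {q : ℕ} {X : Type} [TopologicalSpace X] {c : CyclicCover m q X} {F : X ≃ₜ X},
        c.IsLift F φ → ∃ k : ℤ, ∀ i j, c.actionMatrix F i j =
          laurentHom c.deckUnit (LaurentPolynomial.T k * N i j) := by
  obtain ⟨f, hf⟩ := QuotientGroup.mk_surjective (φ : MappingClassGroup S)
  have hp : m.PreservesCrossing f :=
    m.preservesCrossing_of_H1map (H1map_eq_id_of_mem_torelli (hf ▸ φ.2))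
  let β := PathConnectedSpace.somePath m.base (f m.base)
  refine ⟨m.foxMatrix laurentUnit f β, fun {q X _ c F} h => ?_⟩
  obtain ⟨f', hf', hF⟩ := id h
  obtain ⟨β', hβ'⟩ := h.isActionMatrix.eq_foxMatrix hF
  obtain ⟨k, hk⟩ := m.exists_fox_twist_eq hp (hf.trans hf'.symm) β β'
  refine ⟨k, fun i j => ?_⟩
  have e := congrFun (hk c.deckUnit j) i
  have e' := congrFun (congrFun (m.foxMatrix_eq_map c.deckUnit f β) i) j
  rw [hβ', map_mul, laurentHom_T]
  exact e.trans (congrArg (fun a => ((c.deckUnit ^ k : c.DeckRingˣ) : c.DeckRing) * a) e')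

theorem HasWidth.mul {τ : Multiplicative ℤ ≃* c.Deck} {φ φ' : Torelli S} {n n' : ℕ}
    (h : c.HasWidth τ φ n) (h' : c.HasWidth τ φ' n') : c.HasWidth τ (φ * φ') (n + n') := by
  obtain ⟨F, hF, hw⟩ := h
  obtain ⟨F', hF', hw'⟩ := h'
  have hFF : c.IsLift (F * F') (φ * φ' : Torelli S) := hF.mul hF'
  refine ⟨F * F', hFF, fun k j => ?_⟩
  rw [hFF.isActionMatrix.unique (hF.isActionMatrix.mul hF hF'.isActionMatrix)]
  rw [Matrix.of_apply, map_sum]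
  refine AddSubgroup.sum_mem _ fun i _ => ?_
  rw [map_mul, mul_comm]
  exact mul_mem_laurentWidth (hw _ _) (hw' _ _)

theorem hasWidth_one (c : CyclicCover m q X) (τ : Multiplicative ℤ ≃* c.Deck) :
    c.HasWidth τ 1 0 := by
  have h : c.IsLift 1 (1 : Torelli S) := ⟨1, rfl, fun _ => rfl⟩
  refine ⟨1, h, fun i j => ?_⟩
  rw [h.isActionMatrix.unique (M' := 1)]
  · rw [Matrix.one_apply]
    split_ifs
    · rw [map_one]; exact one_mem_laurentWidth 0
    · rw [map_zero]; exact zero_mem _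
  · intro j
    rw [Finset.sum_eq_single j]
    · have e : homeoMap (1 : X ≃ₜ X) = ContinuousMap.id X := rfl
      rw [Matrix.one_apply_eq, e, H1map_id, map_one]
      rfl
    · intro i _ hi
      rw [Matrix.one_apply_ne hi, map_zero, LinearMap.zero_apply]
    · simp

theorem exists_hasWidth (c : CyclicCover m q X) (τ : Multiplicative ℤ ≃* c.Deck) (φ : Torelli S) :
    ∃ n, c.HasWidth τ φ n := by
  obtain ⟨F, hF⟩ := c.exists_lift_of_torelli φ
  choose n hn using fun z : (Fin r ⊕ Fin r) × (Fin r ⊕ Fin r) =>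
    exists_mem_laurentWidth (c.toLaurent τ (c.actionMatrix F z.1 z.2))
  exact ⟨Finset.univ.sup n, F, hF, fun i j =>
    laurentWidth_mono (Finset.le_sup (Finset.mem_univ (i, j))) (hn (i, j))⟩

/-- Widths add under products, so `C` can be the largest width of a step of the walk. -/
theorem exists_hasWidth_convPow (c : CyclicCover m q X) (τ : Multiplicative ℤ ≃* c.Deck)
    (μ : PMF (Torelli S)) (hμ : μ.support.Finite) :
    ∃ C : ℕ, ∀ n, ∀ φ ∈ (convPow μ n).support, c.HasWidth τ φ (C * n) := by
  choose w hw using c.exists_hasWidth τ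
  refine ⟨hμ.toFinset.sup w, fun n => ?_⟩
  induction n with
  | zero =>
    intro φ hφ
    rw [convPow, PMF.support_pure, Set.mem_singleton_iff] at hφ
    rw [hφ, mul_zero]
    exact c.hasWidth_one τ
  | succ n ih =>
    intro φ hφ
    rw [convPow, PMF.mem_support_bind_iff] at hφ
    obtain ⟨x, hx, hφ⟩ := hφ
    rw [PMF.support_map] at hφ
    obtain ⟨y, hy, rfl⟩ := hφ
    rw [mul_add, mul_one]
    exact (ih x hx).mul ((hw y).mono (Finset.le_sup (hμ.mem_toFinset.2 hy)))

end CyclicCover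

/-! ### Cyclotomic polynomials on the unit circle -/

/-- The squares of the two sides differ by `(R - 1) (R + 1 - 2 ⟨z, w⟩)`, and `⟨z, w⟩ ≤ 1`. -/
theorem norm_sub_le_norm_mul_sub {R : ℝ} (hR : 1 ≤ R) {z w : ℂ} (hz : ‖z‖ = 1) (hw : ‖w‖ = 1) :
    ‖z - w‖ ≤ ‖(R : ℂ) * z - w‖ := by
  refine le_of_sq_le_sq ?_ (norm_nonneg _)
  have e : (R : ℂ) * z = R • z := (Complex.real_smul).symm
  have h : inner ℝ z w ≤ 1 := by simpa [hz, hw] using real_inner_le_norm z w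
  rw [e, norm_sub_sq_real, norm_sub_sq_real, norm_smul, real_inner_smul_left, hz, hw,
    Real.norm_of_nonneg (by linarith)]
  nlinarith

theorem abs_log_norm_pow_sub_one_le {R : ℝ} (hR : 1 < R) {w : ℂ} (hw : ‖w‖ = R) {n : ℕ}
    (hn : 0 < n) :
    |Real.log ‖w ^ n - 1‖ - n * Real.log R| ≤ (1 - R⁻¹)⁻¹ * R⁻¹ ^ n := by
  have hR0 : 0 < R := by linarith
  have hy : R⁻¹ < 1 := inv_lt_one_of_one_lt₀ hR
  have hy0 : 0 < R⁻¹ := inv_pos.2 hR0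
  have hyn : R⁻¹ ^ n ≤ R⁻¹ := pow_le_of_le_one hy0.le hy.le hn.ne'
  have hyn0 : 0 < R⁻¹ ^ n := pow_pos hy0 n
  have hRn : 0 < R ^ n := pow_pos hR0 n
  have hnorm : ‖w ^ n‖ = R ^ n := by rw [norm_pow, hw]
  have hupper : ‖w ^ n - 1‖ ≤ R ^ n * (1 + R⁻¹ ^ n) := by
    have := norm_sub_le (w ^ n) 1
    rw [hnorm, norm_one] at this
    rwa [mul_add, mul_one, inv_pow, mul_inv_cancel₀ hRn.ne']
  have hlower : R ^ n * (1 - R⁻¹ ^ n) ≤ ‖w ^ n - 1‖ := by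
    have := norm_sub_norm_le (w ^ n) 1
    rw [hnorm, norm_one] at this
    rwa [mul_sub, mul_one, inv_pow, mul_inv_cancel₀ hRn.ne']
  have hpos : 0 < R ^ n * (1 - R⁻¹ ^ n) := mul_pos hRn (by linarith)
  have hc : 1 ≤ (1 - R⁻¹)⁻¹ := (one_le_inv₀ (by linarith)).2 (by linarith)
  have h1 := Real.log_le_log (hpos.trans_le hlower) hupper
  have h2 := Real.log_le_log hpos hlower
  rw [Real.log_mul hRn.ne' (by linarith), Real.log_pow] at h1 h2
  have h3 : Real.log (1 + R⁻¹ ^ n) ≤ R⁻¹ ^ n := by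
    have := Real.log_le_sub_one_of_pos (x := 1 + R⁻¹ ^ n) (by linarith)
    linarith
  have h4 : -((1 - R⁻¹)⁻¹ * R⁻¹ ^ n) ≤ Real.log (1 - R⁻¹ ^ n) := by
    have h := Real.one_sub_inv_le_log_of_pos (x := 1 - R⁻¹ ^ n) (by linarith)
    refine le_trans ?_ h
    have h5 : (1 - R⁻¹ ^ n)⁻¹ ≤ (1 - R⁻¹)⁻¹ := inv_anti₀ (by linarith) (by linarith)
    have h6 : 1 - (1 - R⁻¹ ^ n)⁻¹ = -((1 - R⁻¹ ^ n)⁻¹ * R⁻¹ ^ n) := by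
      have : 1 - R⁻¹ ^ n ≠ 0 := by linarith
      linear_combination -(mul_inv_cancel₀ this)
    rw [h6]
    exact neg_le_neg (mul_le_mul_of_nonneg_right h5 hyn0.le)
  rw [abs_le]
  constructor
  · linarith
  · nlinarith

open Polynomial in
-- Off the unit circle `log |wⁿ - 1|` is `n log R` up to an error `O(R⁻ⁿ)`. Subtracting the main
-- terms, which match since `∑ φ(i) = n` over the divisors of `n`, and applying Möbius inversion
-- bounds the error for `Φ_n` by a geometric series, uniformly in `n`.
theorem log_norm_cyclotomic_le {R : ℝ} (hR : 1 < R) {w : ℂ} (hw : ‖w‖ = R) {n : ℕ}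
    (hn : 0 < n) : (cyclotomic n ℂ).eval w ≠ 0 ∧
    Real.log ‖(cyclotomic n ℂ).eval w‖ ≤ n.totient * Real.log R + (1 - R⁻¹)⁻¹ * (1 - R⁻¹)⁻¹ := by
  have hR0 : 0 < R := by linarith
  have hy : R⁻¹ < 1 := inv_lt_one_of_one_lt₀ hR
  have hy0 : 0 < R⁻¹ := inv_pos.2 hR0
  have hprod {n : ℕ} (hn : 0 < n) :
      ∏ i ∈ n.divisors, (cyclotomic i ℂ).eval w = w ^ n - 1 := by
    rw [← eval_prod, prod_cyclotomic_eq_X_pow_sub_one hn]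
    simp
  have hne {n : ℕ} (hn : 0 < n) : w ^ n - 1 ≠ 0 := by
    intro h
    have h' : ‖w ^ n‖ = 1 := by rw [sub_eq_zero.1 h, norm_one]
    rw [norm_pow, hw] at h'
    exact (one_lt_pow₀ hR hn.ne').ne' h'
  have hne' {n : ℕ} (hn : 0 < n) : ∀ i ∈ n.divisors, (cyclotomic i ℂ).eval w ≠ 0 :=
    Finset.prod_ne_zero_iff.1 (by rw [hprod hn]; exact hne hn)
  refine ⟨hne' hn n (Nat.mem_divisors_self n hn.ne'), ?_⟩
  have hsum : ∀ n : ℕ, n > 0 → ∑ i ∈ n.divisors,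
      (Real.log ‖(cyclotomic i ℂ).eval w‖ - i.totient * Real.log R) =
        Real.log ‖w ^ n - 1‖ - n * Real.log R := by
    intro n hn
    rw [Finset.sum_sub_distrib, ← Real.log_prod fun i hi => norm_ne_zero_iff.2 (hne' hn i hi),
      ← norm_prod, hprod hn, ← Finset.sum_mul, ← Nat.cast_sum, Nat.sum_totient]
  have hmoebius := ArithmeticFunction.sum_eq_iff_sum_mul_moebius_eq.1 hsum n hn
  have hbound : Real.log ‖(cyclotomic n ℂ).eval w‖ - n.totient * Real.log R ≤
      ∑ x ∈ n.divisorsAntidiagonal, (1 - R⁻¹)⁻¹ * R⁻¹ ^ x.2 := by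
    rw [← hmoebius]
    refine Finset.sum_le_sum fun x hx => (le_abs_self _).trans ?_
    have hx2 : 0 < x.2 := Nat.pos_of_mem_divisors (Nat.snd_mem_divisors_of_mem_antidiagonal hx)
    rw [abs_mul]
    have h1 : |((ArithmeticFunction.moebius x.1 : ℤ) : ℝ)| ≤ 1 := by
      rw [← Int.cast_abs]
      exact_mod_cast ArithmeticFunction.abs_moebius_le_one
    exact (mul_le_of_le_one_left (abs_nonneg _) h1).trans (abs_log_norm_pow_sub_one_le hR hw hx2)
  have hgeom : ∑ x ∈ n.divisorsAntidiagonal, (1 - R⁻¹)⁻¹ * R⁻¹ ^ x.2 ≤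
      (1 - R⁻¹)⁻¹ * (1 - R⁻¹)⁻¹ := by
    rw [← Finset.mul_sum, Nat.sum_divisorsAntidiagonal' (f := fun _ i => R⁻¹ ^ i),
      ← tsum_geometric_of_lt_one hy0.le hy]
    refine mul_le_mul_of_nonneg_left ?_ ?_
    · exact (summable_geometric_of_lt_one hy0.le hy).sum_le_tsum _ fun i _ => (pow_pos hy0 i).le
    · rw [tsum_geometric_of_lt_one hy0.le hy]
      exact inv_nonneg.2 (by linarith)
  linarith

open Polynomial in
-- All roots of `Φ_n` lie on the unit circle, so moving `z` radially outwards to radius `R`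
-- increases the distance to each of them.
theorem norm_cyclotomic_le {R : ℝ} (hR : 1 < R) {z : ℂ} (hz : ‖z‖ = 1) {n : ℕ} (hn : 0 < n) :
    ‖(cyclotomic n ℂ).eval z‖ ≤
      Real.exp (n.totient * Real.log R + (1 - R⁻¹)⁻¹ * (1 - R⁻¹)⁻¹) := by
  have hw : ‖(R : ℂ) * z‖ = R := by
    rw [norm_mul, hz, mul_one, Complex.norm_real, Real.norm_of_nonneg (by linarith)]
  obtain ⟨h0, h1⟩ := log_norm_cyclotomic_le hR hw hn
  refine le_trans ?_ ((Real.log_le_iff_le_exp (norm_pos_iff.2 h0)).1 h1)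
  rw [cyclotomic_eq_prod_X_sub_primitiveRoots (Complex.isPrimitiveRoot_exp n hn.ne'), eval_prod,
    eval_prod, norm_prod, norm_prod]
  refine Finset.prod_le_prod (fun _ _ => norm_nonneg _) fun ζ hζ => ?_
  simp only [eval_sub, eval_X, eval_C]
  exact norm_sub_le_norm_mul_sub hR.le hz
    ((isPrimitiveRoot_of_mem_primitiveRoots hζ).norm'_eq_one hn.ne')

open Polynomial in
-- Northcott's theorem: only finitely many integral polynomials have bounded degree and Mahler
-- measure at most one, and distinct `k` give distinct `Φ_k`.
theorem finite_totient_le (D : ℕ) : {k : ℕ | k.totient ≤ D}.Finite := by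
  refine Set.Finite.of_injOn (f := fun k => cyclotomic k ℤ) (fun k hk => ?_)
    cyclotomic_injective.injOn (finite_mahlerMeasure_le D 1)
  refine ⟨by rwa [natDegree_cyclotomic], ?_⟩
  exact (cyclotomic_mahlerMeasure_eq_one (R := ℤ) k).le

open Polynomial in
theorem exists_finset_norm_cyclotomic_le {ε : ℝ} (hε : 0 < ε) : ∃ K : Finset ℕ, 0 ∉ K ∧
    ∀ n, 0 < n → n ∉ K → ∀ z : ℂ, ‖z‖ = 1 →
      ‖(cyclotomic n ℂ).eval z‖ ≤ Real.exp (ε * n.totient) := by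
  -- Half of `ε` pays for the factor `log R`; the other half absorbs the constant once `φ(n) > D`.
  obtain ⟨R, hR, hlog⟩ : ∃ R : ℝ, 1 < R ∧ Real.log R = ε / 2 :=
    ⟨Real.exp (ε / 2), Real.one_lt_exp_iff.2 (by linarith), Real.log_exp _⟩
  obtain ⟨D, hD⟩ := exists_nat_gt ((1 - R⁻¹)⁻¹ * (1 - R⁻¹)⁻¹ / (ε / 2))
  refine ⟨(finite_totient_le D).toFinset.erase 0, Finset.notMem_erase _ _, fun n hn hK z hz => ?_⟩
  refine (norm_cyclotomic_le hR hz hn).trans (Real.exp_le_exp.2 ?_)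
  have hn' : D < n.totient := by
    by_contra h
    exact hK (Finset.mem_erase.2 ⟨hn.ne', (Set.Finite.mem_toFinset _).2 (not_lt.1 h)⟩)
  have h1 : (D : ℝ) < n.totient := by exact_mod_cast hn'
  rw [div_lt_iff₀ (by linarith)] at hD
  rw [hlog]
  nlinarith

open Polynomial in
-- By Kronecker's theorem a nonconstant `p` of Mahler measure one has a factor `X` or `Φ_n`.
-- Splitting it off lowers the degree and keeps the Mahler measure, and the bounds multiply because
-- degrees add.
theorem norm_eval_le_of_mahlerMeasure_eq_one {ε : ℝ} (hε : 0 < ε) {K : Finset ℕ}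
    (hK : ∀ n, 0 < n → n ∉ K → ∀ z : ℂ, ‖z‖ = 1 →
      ‖(cyclotomic n ℂ).eval z‖ ≤ Real.exp (ε * n.totient)) {z : ℂ} (hz : ‖z‖ = 1) (p : ℤ[X])
    (hp : (p.map (Int.castRingHom ℂ)).mahlerMeasure = 1)
    (hdvd : ∀ k ∈ K, ¬ cyclotomic k ℤ ∣ p) :
    ‖(p.map (Int.castRingHom ℂ)).eval z‖ ≤ Real.exp (ε * p.natDegree) := by
  induction hN : p.natDegree using Nat.strong_induction_on generalizing p with
  | _ N ih =>
    have hp0 : p ≠ 0 := by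
      rintro rfl
      simp at hp
    have step (a b : ℤ[X]) (hab : p = a * b) (ha : 0 < a.natDegree)
        (hM : (a.map (Int.castRingHom ℂ)).mahlerMeasure = 1)
        (hle : ‖(a.map (Int.castRingHom ℂ)).eval z‖ ≤ Real.exp (ε * a.natDegree)) :
        ‖(p.map (Int.castRingHom ℂ)).eval z‖ ≤ Real.exp (ε * N) := by
      have hdeg : N = a.natDegree + b.natDegree := by
        rw [← hN, hab, natDegree_mul] <;> (rintro rfl; simp [hab] at hp0)
      have hb := ih b.natDegree (by omega) b (by
        rw [hab, Polynomial.map_mul, mahlerMeasure_mul, hM, one_mul] at hp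
        exact hp) (fun k hk h => hdvd k hk (hab ▸ h.mul_left a)) rfl
      rw [hab, Polynomial.map_mul, eval_mul, norm_mul, hdeg, Nat.cast_add, mul_add, Real.exp_add]
      exact mul_le_mul hle hb (norm_nonneg _) (Real.exp_pos _).le
    by_cases hX : X ∣ p
    · obtain ⟨b, hb⟩ := hX
      refine step X b hb (by simp) ?_ ?_
      · simpa using mahlerMeasure_X_sub_C 0
      · rw [Polynomial.map_X, eval_X, hz]
        exact Real.one_le_exp (by positivity)
    by_cases hd : p.degree = 0
    · obtain ⟨a, rfl⟩ := natDegree_eq_zero.1 (natDegree_eq_zero_iff_degree_le_zero.2 hd.le)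
      rw [map_C, mahlerMeasure_const] at hp
      rw [map_C, eval_C, hp]
      exact Real.one_le_exp (by positivity)
    · obtain ⟨n, hn, b, hb⟩ := cyclotomic_dvd_of_mahlerMeasure_eq_one hp hX hd
      refine step _ b hb ?_ (cyclotomic_mahlerMeasure_eq_one (R := ℤ) n) ?_
      · rw [natDegree_cyclotomic]
        exact Nat.totient_pos.2 hn
      · rw [map_cyclotomic_int, natDegree_cyclotomic]
        exact hK n hn (fun h => hdvd n h ⟨b, hb⟩) z hz

/-! ### Laurent polynomials of Mahler measure one -/

theorem laurentEval_T_mul_toLaurent (a : ℤ) (p : Polynomial ℤ) (z : ℂˣ) :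
    laurentEval (LaurentPolynomial.T a * p.toLaurent) z =
      z ^ a * (p.map (Int.castRingHom ℂ)).eval (z : ℂ) := by
  rw [laurentEval_eq_laurentHom, map_mul, laurentHom_T, Units.val_zpow_eq_zpow_val]
  congr 1
  have h : (laurentHom z : ℤ[T;T⁻¹] →ₐ[ℤ] ℂ).comp Polynomial.toLaurentAlg =
      Polynomial.aeval (z : ℂ) := by
    refine Polynomial.algHom_ext ?_
    simp [laurentHom_T]
  refine (DFunLike.congr_fun h p).trans ?_
  rw [Polynomial.eval_map, Polynomial.aeval_def]
  rfl

theorem laurentMahler_T_mul_toLaurent (a : ℤ) (p : Polynomial ℤ) :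
    laurentMahler (LaurentPolynomial.T a * p.toLaurent) =
      (p.map (Int.castRingHom ℂ)).logMahlerMeasure := by
  rw [laurentMahler, Polynomial.logMahlerMeasure_def]
  refine Real.circleAverage_congr_sphere fun z hz => ?_
  have hz1 : ‖z‖ = 1 := by simpa using hz
  have hz0 : z ≠ 0 := norm_ne_zero_iff.1 (by rw [hz1]; exact one_ne_zero)
  have := laurentEval_T_mul_toLaurent a p (Units.mk0 z hz0)
  rw [Units.val_mk0] at this
  simp only [this, norm_mul, norm_zpow, hz1, one_zpow, one_mul]

theorem exists_finset_norm_laurentEval_le {α : ℝ} (hα : 0 < α) (D : ℕ) :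
    ∃ K : Finset ℕ, 0 ∉ K ∧ ∀ (n : ℕ) (P : ℤ[T;T⁻¹]) (a : ℤ) (p : Polynomial ℤ),
      p.natDegree ≤ D * n → P = LaurentPolynomial.T a * p.toLaurent → laurentMahler P = 0 →
      (∃ k ∈ K, (Polynomial.cyclotomic k ℤ).toLaurent ∣ P) ∨
        ∀ z : ℂˣ, ‖(z : ℂ)‖ = 1 → ‖laurentEval P z‖ ≤ Real.exp (α * n) := by
  -- The denominator is `D + 1` so that `D = 0` is allowed.
  have hD : (0 : ℝ) < D + 1 := by positivity
  have hε : 0 < α / (D + 1) := div_pos hα hD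
  obtain ⟨K, hK0, hK⟩ := exists_finset_norm_cyclotomic_le hε
  refine ⟨K, hK0, ?_⟩
  rintro n _ a p hp rfl hM
  rw [laurentMahler_T_mul_toLaurent] at hM
  by_cases hdvd : ∃ k ∈ K, Polynomial.cyclotomic k ℤ ∣ p
  · left
    obtain ⟨k, hk, b, rfl⟩ := hdvd
    exact ⟨k, hk, Dvd.dvd.mul_left ⟨_, map_mul _ _ _⟩ _⟩
  · right
    push Not at hdvd
    intro z hz
    rw [laurentEval_T_mul_toLaurent, norm_mul, norm_zpow, hz, one_zpow, one_mul]
    -- The zero polynomial also has logarithmic Mahler measure `0`, by the convention `log 0 = 0`,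
    -- but not Mahler measure one.
    by_cases hp0 : p = 0
    · rw [hp0]
      simpa using (Real.exp_pos _).le
    have hM1 : (p.map (Int.castRingHom ℂ)).mahlerMeasure = 1 := by
      rw [Polynomial.mahlerMeasure, if_pos, hM, Real.exp_zero]
      exact (Polynomial.map_ne_zero_iff (Int.castRingHom ℂ).injective_int).2 hp0
    refine (norm_eval_le_of_mahlerMeasure_eq_one hε hK hz p hM1 hdvd).trans
      (Real.exp_le_exp.2 ?_)
    have h1 : (p.natDegree : ℝ) ≤ D * n := by exact_mod_cast hp
    have h2 : α / (D + 1) * p.natDegree ≤ α / (D + 1) * ((D + 1) * n) := by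
      refine mul_le_mul_of_nonneg_left (h1.trans ?_) hε.le
      nlinarith [(Nat.cast_nonneg n : (0 : ℝ) ≤ n)]
    rwa [← mul_assoc, div_mul_cancel₀ _ hD.ne'] at h2

/-! ### The entry of the exterior power -/

/-- The pairing of decomposable vectors is the determinant of the inner products `(M x i, y j)`,
which form the transposed block. -/
theorem wedgeEntry_toEuclideanLin {r : ℕ} (M : Matrix (Fin r ⊕ Fin r) (Fin r ⊕ Fin r) ℂ) :
    wedgeEntry (Matrix.toEuclideanLin M) = M.toBlocks₂₁.det := by
  rw [wedgeEntry, exteriorPower.map_apply_ιMulti, innerWedge_ιMulti, ← Matrix.det_transpose]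
  congr 1
  ext i j
  simp [Matrix.toBlocks₂₁, EuclideanSpace.inner_single_left, Matrix.toLpLin_apply]

theorem det_laurentHom_T_mul {R : Type} [CommRing R] {r : ℕ} (u : Rˣ) (k : ℤ)
    (N : Matrix (Fin r) (Fin r) ℤ[T;T⁻¹]) :
    (Matrix.of fun i j => laurentHom u (LaurentPolynomial.T k * N i j)).det =
      ((u ^ k : Rˣ) : R) ^ r * laurentHom u N.det := by
  have h : (Matrix.of fun i j => laurentHom u (LaurentPolynomial.T k * N i j)) =
      ((u ^ k : Rˣ) : R) • (laurentHom u : ℤ[T;T⁻¹] →+* R).mapMatrix N := by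
    ext1 i j
    rw [Matrix.of_apply, map_mul, laurentHom_T]
    rfl
  rw [h, Matrix.det_smul, Fintype.card_fin, ← RingHom.map_det]
  rfl

namespace CyclicCover

variable {r : ℕ} {S : Type} [TopologicalSpace S]
  {m : StandardSystem (r + 1) S} {q : ℕ} {X : Type} [TopologicalSpace X]
  [PathConnectedSpace S] [LocallyPathConnectedSpace S] {c : CyclicCover m q X}

/-- The identification `τ` may match `t` with the deck transformation of degree one or with its
inverse; `s = ±1` records which. -/
theorem exists_toLaurent_laurentHom (c : CyclicCover m q X) (τ : Multiplicative ℤ ≃* c.Deck) :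
    ∃ s : ℤ, s * s = 1 ∧ ∀ P, c.toLaurent τ (laurentHom c.deckUnit P) =
      laurentHom (laurentUnit ^ s) P := by
  obtain ⟨k, hk⟩ := exists_hasDegree (τ (Multiplicative.ofAdd 1))
  have h := congrArg τ.symm hk.eq_zpow
  rw [MulEquiv.symm_apply_apply, map_zpow] at h
  have h' : (1 : ℤ) = k * (τ.symm c.deckGen).toAdd := by
    have := congrArg Multiplicative.toAdd h
    simpa using this
  refine ⟨(τ.symm c.deckGen).toAdd, ?_, fun P => ?_⟩
  · rcases Int.isUnit_iff.1 (IsUnit.of_mul_eq_one _ ((mul_comm _ _).trans h'.symm)) with e | e <;>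
      rw [e] <;> rfl
  · refine (map_laurentHom (c.toLaurent τ : c.DeckRing →+* ℤ[T;T⁻¹]) _ P).trans ?_
    congr 2
    ext1
    rw [laurentUnit_zpow]
    exact (MonoidAlgebra.lift_of _ _)

/-- The determinants of the blocks of all lifts of `φ` come from one Laurent polynomial. -/
theorem exists_laurent_det (m : StandardSystem (r + 1) S) (φ : Torelli S) : ∃ P : ℤ[T;T⁻¹],
    (∀ {q : ℕ} {X : Type} [TopologicalSpace X] (c : CyclicCover m q X)
      (τ : Multiplicative ℤ ≃* c.Deck), ∃ s : ℤ, s * s = 1 ∧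
        ∀ F, c.IsLift F φ → ∃ k : ℤ,
          (c.B τ F).det = LaurentPolynomial.T k * laurentHom (laurentUnit ^ s) P) ∧
    ∀ {q : ℕ} {X : Type} [TopologicalSpace X] (c : CyclicCover m q X) (ι : c.DeckRing →+* ℂ) (F),
      c.IsLift F φ → ∃ k : ℤ, wedgeEntry (c.rho ι F) =
        ((Units.map ι.toMonoidHom c.deckUnit ^ k : ℂˣ) : ℂ) ^ r *
          laurentHom (Units.map ι.toMonoidHom c.deckUnit) P := by
  obtain ⟨N, hN⟩ := exists_laurentMatrix m φ
  refine ⟨N.toBlocks₂₁.det, fun c τ => ?_, fun c ι F hF => ?_⟩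
  · obtain ⟨s, hs, h⟩ := c.exists_toLaurent_laurentHom τ
    refine ⟨s, hs, fun F hF => ?_⟩
    obtain ⟨k, hk⟩ := hN hF
    refine ⟨s * k * r, ?_⟩
    have e : c.B τ F = Matrix.of fun i j =>
        laurentHom (laurentUnit ^ s) (LaurentPolynomial.T k * N.toBlocks₂₁ i j) := by
      ext1 i j
      rw [Matrix.of_apply, ← h]
      exact congrArg (c.toLaurent τ) (hk (Sum.inr i) (Sum.inl j))
    rw [e, det_laurentHom_T_mul, ← zpow_mul, laurentUnit_zpow, LaurentPolynomial.T_pow, mul_comm (r : ℤ)]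
  · obtain ⟨k, hk⟩ := hN hF
    refine ⟨k, ?_⟩
    rw [rho, wedgeEntry_toEuclideanLin, ← det_laurentHom_T_mul]
    congr 1
    ext1 i j
    rw [Matrix.of_apply, ← map_laurentHom]
    exact congrArg ι (hk (Sum.inr i) (Sum.inl j))

/-- The given generator and the deck transformation of degree one are powers of each other, so their
images have the same order. -/
theorem IsPrimitive.isPrimitiveRoot_deckUnit {ι : c.DeckRing →+* ℂ} (h : c.IsPrimitive ι) :
    IsPrimitiveRoot (Units.map ι.toMonoidHom c.deckUnit) q := by
  obtain ⟨d, hd, hι⟩ := h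
  let χ : c.Deck →* ℂˣ := (Units.map (ι.toMonoidHom.comp (MonoidAlgebra.of ℤ c.Deck))).comp
    (toUnits (G := c.Deck)).toMonoidHom
  have hχ : IsPrimitiveRoot (χ d) q := IsPrimitiveRoot.coe_units_iff.1 hι
  have hgen : Units.map ι.toMonoidHom c.deckUnit = χ c.deckGen := rfl
  obtain ⟨k, hk⟩ := exists_hasDegree d
  obtain ⟨l, hl⟩ := hd c.deckGen
  rw [hgen]
  constructor
  · rw [← hl]
    change χ (d ^ l) ^ q = 1
    rw [map_zpow, ← zpow_natCast, ← zpow_mul, mul_comm, zpow_mul, zpow_natCast, hχ.pow_eq_one,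
      one_zpow]
  · intro n hn
    refine hχ.dvd_of_pow_eq_one n ?_
    rw [hk.eq_zpow, map_zpow, ← zpow_natCast, ← zpow_mul, mul_comm, zpow_mul, zpow_natCast, hn,
      one_zpow]

/-- Both sides are values of the one Laurent polynomial `P` of `φ`, up to powers of numbers of
modulus one. The point `z = w ^ s` undoes the possible substitution `t ↦ t⁻¹`. -/
theorem exists_norm_wedgeEntry_eq {q₀ : ℕ} {X₀ : Type} [TopologicalSpace X₀]
    {c₀ : CyclicCover m q₀ X₀} (τ : Multiplicative ℤ ≃* c₀.Deck) {φ : Torelli S} {F₀ : X₀ ≃ₜ X₀}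
    (hF₀ : c₀.IsLift F₀ φ) (hq : 1 ≤ q) {ι : c.DeckRing →+* ℂ} (hι : c.IsPrimitive ι)
    {F : X ≃ₜ X} (hF : c.IsLift F φ) : ∃ z : ℂˣ, IsPrimitiveRoot (z : ℂ) q ∧
      ‖wedgeEntry (c.rho ι F)‖ = ‖laurentHom z (c₀.B τ F₀).det‖ := by
  obtain ⟨P, h₀, h⟩ := exists_laurent_det m φ
  obtain ⟨s, hs, h₀⟩ := h₀ c₀ τ
  obtain ⟨k₀, h₀⟩ := h₀ F₀ hF₀
  obtain ⟨k, h⟩ := h c ι F hF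
  have hw := hι.isPrimitiveRoot_deckUnit
  generalize Units.map ι.toMonoidHom c.deckUnit = w at h hw
  have hw1 : ‖(w : ℂ)‖ = 1 :=
    (IsPrimitiveRoot.coe_units_iff.2 hw).norm'_eq_one (Nat.one_le_iff_ne_zero.1 hq)
  have hnorm (k : ℤ) : ‖((w ^ k : ℂˣ) : ℂ)‖ = 1 := by
    rw [Units.val_zpow_eq_zpow_val, norm_zpow, hw1, one_zpow]
  have hu : Units.map (laurentHom (w ^ s) : ℤ[T;T⁻¹] →+* ℂ).toMonoidHom (laurentUnit ^ s) = w := by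
    rw [map_zpow, map_laurentUnit, ← zpow_mul, hs, zpow_one]
  refine ⟨w ^ s, IsPrimitiveRoot.coe_units_iff.2 ?_, ?_⟩
  · refine hw.zpow_of_gcd_eq_one s ?_
    rcases Int.isUnit_iff.1 (IsUnit.of_mul_eq_one _ hs) with rfl | rfl <;> simp
  · have e := map_laurentHom (laurentHom (w ^ s) : ℤ[T;T⁻¹] →+* ℂ) (laurentUnit ^ s) P
    rw [hu] at e
    change laurentHom (w ^ s) _ = _ at e
    rw [h, h₀, map_mul, e, laurentHom_T, ← zpow_mul, norm_mul, norm_mul, norm_pow, hnorm, hnorm,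
      one_pow]

/-- The width is known for one lift only, but the determinants of any two lifts differ by a power of
`t`, which goes into `a` and leaves the degree of `p` unchanged. -/
theorem exists_toLaurent_eq_det {τ : Multiplicative ℤ ≃* c.Deck} {φ : Torelli S} {n : ℕ}
    (h : c.HasWidth τ φ n) {F : X ≃ₜ X} (hF : c.IsLift F φ) : ∃ (a : ℤ) (p : Polynomial ℤ),
      p.natDegree ≤ 2 * (r * n) ∧ (c.B τ F).det = LaurentPolynomial.T a * p.toLaurent := by
  obtain ⟨F', hF', hw⟩ := h
  obtain ⟨p, hp, hp'⟩ := det_mem_laurentWidth (N := c.B τ F') fun i j => hw (Sum.inr i) (Sum.inl j)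
  obtain ⟨P, h, -⟩ := exists_laurent_det m φ
  obtain ⟨s, -, h⟩ := h c τ
  obtain ⟨k, hk⟩ := h F hF
  obtain ⟨k', hk'⟩ := h F' hF'
  refine ⟨k - k' + (-(r * n : ℕ) : ℤ), p, hp, ?_⟩
  rw [LaurentPolynomial.T_add, mul_assoc, ← hp', hk', ← mul_assoc, ← LaurentPolynomial.T_add,
    sub_add_cancel, hk]

end CyclicCover

theorem laurentHom_cyclotomic_dvd {k : ℕ} (hk : 0 < k) {P : ℤ[T;T⁻¹]}
    (h : (Polynomial.cyclotomic k ℤ).toLaurent ∣ P) {z : ℂˣ} (hz : IsPrimitiveRoot (z : ℂ) k) :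
    laurentHom z P = 0 := by
  obtain ⟨Q, rfl⟩ := h
  have e := laurentEval_T_mul_toLaurent 0 (Polynomial.cyclotomic k ℤ) z
  rw [LaurentPolynomial.T_zero, one_mul, zpow_zero, one_mul, laurentEval_eq_laurentHom,
    Polynomial.map_cyclotomic_int] at e
  rw [map_mul, e, (hz.isRoot_cyclotomic hk).eq_zero, zero_mul]

end

theorem proposition6p3 (r : ℕ) (hr : 2 ≤ r) (S : Type) [TopologicalSpace S] [T2Space S]
    [CompactSpace S] [ConnectedSpace S] [ChartedSpace (EuclideanSpace ℝ (Fin 2)) S]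
    (m : StandardSystem (r + 1) S) :
    (∀ (q : ℕ) (X : Type) [TopologicalSpace X] (c : CyclicCover m q X) (φ : Torelli S),
      (∃ F, c.IsLift F φ) ∧ ∀ F, c.IsLift F φ → ∃! M, c.IsActionMatrix F M) ∧
    ∀ (X : Type) [TopologicalSpace X] (c : CyclicCover m 0 X) (τ : Multiplicative ℤ ≃* c.Deck)
      (α : ℝ) (_ : 0 < α) (μ : PMF (Torelli S)) (_ : μ.support.Finite)
      (_ : Subsemigroup.closure μ.support = ⊤),
      ∃ K : Finset ℕ, 0 ∉ K ∧
        ∀ (n : ℕ) (φ : Torelli S), φ ∈ (convPow μ n).support →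
        ∀ F : X ≃ₜ X, c.IsLift F φ → laurentMahler (c.B τ F).det = 0 →
          (∃ k ∈ K, (Polynomial.cyclotomic k ℤ).toLaurent ∣ (c.B τ F).det ∧
            ∀ (Y : Type) [TopologicalSpace Y] (c' : CyclicCover m k Y) (ι : c'.DeckRing →+* ℂ),
              c'.IsPrimitive ι → ∀ F' : Y ≃ₜ Y, c'.IsLift F' φ →
                wedgeEntry (c'.rho ι F') = 0) ∨
          (∀ q : ℕ, 1 ≤ q →
            ∀ (Y : Type) [TopologicalSpace Y] (c' : CyclicCover m q Y) (ι : c'.DeckRing →+* ℂ),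
              c'.IsPrimitive ι → ∀ F' : Y ≃ₜ Y, c'.IsLift F' φ →
                ‖wedgeEntry (c'.rho ι F')‖ ≤ Real.exp (α * n)) := by
  have := ChartedSpace.locallyPathConnectedSpace (EuclideanSpace ℝ (Fin 2)) S
  have : PathConnectedSpace S := pathConnectedSpace_iff_connectedSpace.2 inferInstance
  refine ⟨fun q X _ c φ => ⟨c.exists_lift_of_torelli φ, fun F hF =>
    hF.existsUnique_isActionMatrix⟩, fun X _ c τ α hα μ hμ _ => ?_⟩
  obtain ⟨C, hC⟩ := c.exists_hasWidth_convPow τ μ hμ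
  -- Exponents of the entries lie in `[-C n, C n]`, so those of the determinant of size `r` span at
  -- most `2 r C n`. This constant, hence `K`, does not depend on `n` or `φ`.
  obtain ⟨K, hK0, hK⟩ := exists_finset_norm_laurentEval_le hα (2 * (r * C))
  refine ⟨K, hK0, fun n φ hφ F hF hM => ?_⟩
  obtain ⟨a, p, hp, hdet⟩ := CyclicCover.exists_toLaurent_eq_det (hC n φ hφ) hF
  refine (hK n _ a p (hp.trans_eq (by ring)) hdet hM).imp ?_ ?_
  · rintro ⟨k, hk, hdvd⟩
    have hk0 : 0 < k := Nat.pos_of_ne_zero fun h => hK0 (h ▸ hk)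
    refine ⟨k, hk, hdvd, fun Y _ c' ι hι F' hF' => ?_⟩
    obtain ⟨z, hz, h⟩ := CyclicCover.exists_norm_wedgeEntry_eq τ hF hk0 hι hF'
    rwa [laurentHom_cyclotomic_dvd hk0 hdvd hz, norm_zero, norm_eq_zero] at h
  · intro hle q hq Y _ c' ι hι F' hF'
    obtain ⟨z, hz, h⟩ := CyclicCover.exists_norm_wedgeEntry_eq τ hF hq hι hF'
    rw [h, ← laurentEval_eq_laurentHom]
    exact hle z (hz.norm'_eq_one (Nat.one_le_iff_ne_zero.1 hq))
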